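/- **Setting.** All alphabets $\mathcal S_1,\mathcal S_2,\mathcal W,\mathcal W_3,\mathcal X_1,\mathcal X_2,\mathcal X_3,\mathcal Y,\mathcal Y_3$ are finite; entropies and mutual informations are in bits. Let $p(s_1,s_2,w,w_3)$ be a probability mass function, and let $p(y,y_3|x_1,x_2,x_3)$ be a memoryless multiple-access relay channel. The sequences $(S_{1,k},S_{2,k},W_k,W_{3,k})_{k=1}^n$ are i.i.d. with law $p(s_1,s_2,w,w_3)$. A source-channel code of length $n$ consists of encoders $f_i:\mathcal S_i^n\to\mathcal X_i^n$ ($i=1,2$), causal relay functions $x_{3,k}=f_{3,k}(y_3^{k-1},w_3^n)$, $1\le k\le n$, and a decoder $g:\mathcal Y^n\times\mathcal W^n\to\mathcal S_1^n\times\mathcal S_2^n$; given the sources and side information, the outputs satisfy $\Pr(y^n,y_3^n\mid s_1^n,s_2^n,w^n,w_3^n)=\prod_{k=1}^n p(y_k,y_{3,k}|x_{1,k},x_{2,k},x_{3,k})$. The error probability is $P_e^{(n)}=\Pr\big(g(Y^n,W^n)\ne(S_1^n,S_2^n)\big)$. The sources are *reliably transmissible* if there is a sequence of codes with $P_e^{(n)}\to0$.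 The maximal correlation is $\rho^*_{XY}=\sup \mathbb E[f(X)g(Y)]$ over real $f,g$ with $\mathbb E f(X)=\mathbb E g(Y)=0$ and $\mathbb E f(X)^2=\mathbb E g(Y)^2=1$ (and $\sup\emptyset=0$); given an event, it is computed under the conditional law. Let $\mathcal B$ be the set of conditional distributions $p(x_1,x_2|s_1,s_2)$ for which there are $n\ge1$ and conditional distributions $p(x_1|s_1^n)$, $p(x_2|s_2^n)$ such that, whenever $p(s_{1,1},s_{2,1})>0$, $$p(x_1,x_2|s_{1,1},s_{2,1})=\frac1{p(s_{1,1},s_{2,1})}\sum_{s_{1,2}^n,\,s_{2,2}^n}p(x_1|s_1^n)\,p(x_2|s_2^n)\prod_{k=1}^n p(s_{1,k},s_{2,k}).$$ Let $\overline{\mathcal B}$ be the closure of $\mathcal B$ (entrywise convergence). Let $\mathcal B'$ be the set of conditional distributions $p(x_1,x_2|s_1,s_2)$ such that $\rho^*_{X_1X_2}$, $\rho^*_{X_1X_2|s_1}$, $\rho^*_{X_1X_2|s_2}$ and $\rho^*_{X_1X_2|s_1,s_2}$, computed under $p(s_1,s_2)p(x_1,x_2|s_1,s_2)$, are all at most $\rho^*_{S_1S_2}$,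 for all $s_1,s_2$ for which the conditioning event has positive probability. **Theorem.** One has $\mathcal B\subseteq\overline{\mathcal B}\subseteq\mathcal B'$. If the sources are reliably transmissible, then there is a joint distribution $$p(q)\,p(s_1,s_2,w,w_3)\,p(x_1,x_2|s_1,s_2,q)\,p(x_3|x_1,x_2,w_3,q)\,p(y,y_3|x_1,x_2,x_3)$$ with $|\mathcal Q|\le4$ and $p(x_1,x_2|s_1,s_2,Q=q)\in\overline{\mathcal B}\subseteq\mathcal B'$ for every $q\in\mathcal Q$, such that $$H(S_1|S_2,W,W_3)\le I(X_1;Y,Y_3|S_2,X_2,X_3,W,Q),$$ $$H(S_2|S_1,W,W_3)\le I(X_2;Y,Y_3|S_1,X_1,X_3,W,Q),$$ $$H(S_1,S_2|W,W_3)\le I(X_1,X_2;Y,Y_3|X_3,W,Q).$$ -/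

import Mathlib

open scoped BigOperators Topology

noncomputable section

namespace MARC

/-! ### Finite random variables, entropy and mutual information (in bits)

A probability mass function on a finite set `Ω` is an element of `stdSimplex ℝ Ω`; a random
variable is a function on `Ω`. -/

open Classical in
/-- The law of the random variable `X` under the mass function `μ`: `a ↦ Pr (X = a)`. -/
def law {Ω α : Type*} [Fintype Ω] (μ : Ω → ℝ) (X : Ω → α) (a : α) : ℝ :=
  ∑ ω with X ω = a, μ ω

/-- Conditional entropy `H(X | Z) = - ∑ p(x,z) log₂ (p(x,z) / p(z))`
(the terms with `p(x,z) = 0` vanish). -/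
def condEntropy {Ω α γ : Type*} [Fintype Ω] [Fintype α] [Fintype γ]
    (μ : Ω → ℝ) (X : Ω → α) (Z : Ω → γ) : ℝ :=
  -∑ x : α, ∑ z : γ, law μ (fun ω => (X ω, Z ω)) (x, z) *
    Real.logb 2 (law μ (fun ω => (X ω, Z ω)) (x, z) / law μ Z z)

/-- Conditional mutual information
`I(X ; Y | Z) = ∑ p(x,y,z) log₂ (p(x,y,z) p(z) / (p(x,z) p(y,z)))`
(the terms with `p(x,y,z) = 0` vanish). -/
def condMutualInfo {Ω α β γ : Type*} [Fintype Ω] [Fintype α] [Fintype β] [Fintype γ]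
    (μ : Ω → ℝ) (X : Ω → α) (Y : Ω → β) (Z : Ω → γ) : ℝ :=
  ∑ x : α, ∑ y : β, ∑ z : γ, law μ (fun ω => (X ω, Y ω, Z ω)) (x, y, z) *
    Real.logb 2 (law μ (fun ω => (X ω, Y ω, Z ω)) (x, y, z) * law μ Z z /
      (law μ (fun ω => (X ω, Z ω)) (x, z) * law μ (fun ω => (Y ω, Z ω)) (y, z)))

/-- Maximal correlation of a pair of random variables with joint mass function `π`: the supremum of
`E[f(X) g(Y)]` over zero-mean, unit-variance `f(X)`, `g(Y)`. The supremum of the empty set is `0`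
(both by the usual convention and in Mathlib). -/
def maxCorr {α β : Type*} [Fintype α] [Fintype β] (π : α × β → ℝ) : ℝ :=
  sSup {c : ℝ | ∃ (f : α → ℝ) (g : β → ℝ),
    ∑ z, π z * f z.1 = 0 ∧ ∑ z, π z * g z.2 = 0 ∧
    ∑ z, π z * f z.1 ^ 2 = 1 ∧ ∑ z, π z * g z.2 ^ 2 = 1 ∧
    c = ∑ z, π z * (f z.1 * g z.2)}

/-! ### The channel model: codes and reliable transmission -/

section Model

variable {S1 S2 W W3 X1 X2 X3 Y Y3 : Type*}

/-- A source-channel code of block length `n`: two encoders, causal relay functions (at time `k` the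
relay sees the `k` channel outputs received before, and its whole side information), a decoder. -/
structure Code (S1 S2 W W3 X1 X2 X3 Y Y3 : Type*) (n : ℕ) where
  enc1 : (Fin n → S1) → (Fin n → X1)
  enc2 : (Fin n → S2) → (Fin n → X2)
  relay : (k : Fin n) → (Fin k → Y3) → (Fin n → W3) → X3
  dec : (Fin n → Y) → (Fin n → W) → (Fin n → S1) × (Fin n → S2)

/-- The joint mass function of sources, side informations and channel outputs over a block:
the sources and side informations are i.i.d. with law `p`, the channel `P` is memoryless. -/
def Code.jointLaw {n : ℕ} (c : Code S1 S2 W W3 X1 X2 X3 Y Y3 n)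
    (p : S1 × S2 × W × W3 → ℝ) (P : X1 → X2 → X3 → Y × Y3 → ℝ)
    (s1 : Fin n → S1) (s2 : Fin n → S2) (w : Fin n → W) (w3 : Fin n → W3)
    (y : Fin n → Y) (y3 : Fin n → Y3) : ℝ :=
  (∏ k, p (s1 k, s2 k, w k, w3 k)) *
    ∏ k, P (c.enc1 s1 k) (c.enc2 s2 k)
      (c.relay k (fun j => y3 (Fin.castLE k.isLt.le j)) w3) (y k, y3 k)

open Classical in
/-- The average probability of error `Pr ((Ŝ₁ⁿ, Ŝ₂ⁿ) ≠ (S₁ⁿ, S₂ⁿ))`. -/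
def Code.errorProb [Fintype S1] [Fintype S2] [Fintype W] [Fintype W3] [Fintype Y] [Fintype Y3]
    {n : ℕ} (c : Code S1 S2 W W3 X1 X2 X3 Y Y3 n)
    (p : S1 × S2 × W × W3 → ℝ) (P : X1 → X2 → X3 → Y × Y3 → ℝ) : ℝ :=
  ∑ s1 : Fin n → S1, ∑ s2 : Fin n → S2, ∑ w : Fin n → W, ∑ w3 : Fin n → W3,
    ∑ y : Fin n → Y, ∑ y3 : Fin n → Y3,
      if c.dec y w ≠ (s1, s2) then c.jointLaw p P s1 s2 w w3 y y3 else 0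

/-- The sources can be reliably transmitted: some sequence of codes has vanishing error. -/
def ReliablyTransmissible [Fintype S1] [Fintype S2] [Fintype W] [Fintype W3] [Fintype Y]
    [Fintype Y3] (p : S1 × S2 × W × W3 → ℝ) (P : X1 → X2 → X3 → Y × Y3 → ℝ) : Prop :=
  ∃ c : (n : ℕ) → Code S1 S2 W W3 X1 X2 X3 Y Y3 n,
    Filter.Tendsto (fun n => (c n).errorProb p P) Filter.atTop (𝓝 0)

/-- The joint law of the source pair `(S₁, S₂)`. -/
def sourcePair [Fintype S1] [Fintype S2] [Fintype W] [Fintype W3]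
    (p : S1 × S2 × W × W3 → ℝ) : S1 × S2 → ℝ :=
  law p (fun (s1, s2, _, _) => (s1, s2))

end Model

/-! ### The sets of conditional input distributions

A conditional distribution `p(x₁,x₂|s₁,s₂)` is a map `κ : S1 × S2 → X1 × X2 → ℝ` all of whose values
are mass functions. At pairs `(s₁,s₂)` of probability zero its values are irrelevant, and
conditions are imposed only for conditioning events of positive probability. -/

section InputSets

variable {S1 S2 : Type*} (X1 X2 : Type*) [Fintype S1] [Fintype S2] [Fintype X1] [Fintype X2]

/-- The set `B` of the conditional distributions of `(X₁, X₂)` given the first letters of `(S₁ⁿ, S₂ⁿ)`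
that come, for some `n ≥ 1` (here `n = m + 1`), from a Markov chain `X₁ — S₁ⁿ — S₂ⁿ — X₂`,
with `(S₁ⁿ, S₂ⁿ)` i.i.d. with law `pS`. -/
def setB (pS : S1 × S2 → ℝ) : Set (S1 × S2 → X1 × X2 → ℝ) :=
  {κ | (∀ s, κ s ∈ stdSimplex ℝ (X1 × X2)) ∧
    ∃ (m : ℕ) (p1 : (Fin (m + 1) → S1) → X1 → ℝ) (p2 : (Fin (m + 1) → S2) → X2 → ℝ),
      (∀ t, p1 t ∈ stdSimplex ℝ X1) ∧ (∀ t, p2 t ∈ stdSimplex ℝ X2) ∧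
      ∀ (x1 : X1) (x2 : X2) (s1 : S1) (s2 : S2), 0 < pS (s1, s2) →
        κ (s1, s2) (x1, x2) = (1 / pS (s1, s2)) *
          ∑ t1 : Fin m → S1, ∑ t2 : Fin m → S2,
            p1 (Fin.cons s1 t1) x1 * p2 (Fin.cons s2 t2) x2 *
              ∏ k : Fin (m + 1), pS ((Fin.cons s1 t1 : Fin (m + 1) → S1) k,
                (Fin.cons s2 t2 : Fin (m + 1) → S2) k)}

/-- The set `B'` of the conditional distributions for which the maximal correlation of `(X₁, X₂)`,
unconditionally and given `S₁ = s₁`, given `S₂ = s₂`, given `(S₁, S₂) = (s₁, s₂)`, is at most that of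
`(S₁, S₂)`. -/
def setB' (pS : S1 × S2 → ℝ) : Set (S1 × S2 → X1 × X2 → ℝ) :=
  {κ | (∀ s, κ s ∈ stdSimplex ℝ (X1 × X2)) ∧
    maxCorr (fun x => ∑ s, pS s * κ s x) ≤ maxCorr pS ∧
    (∀ s1, 0 < ∑ s2, pS (s1, s2) →
      maxCorr (fun x => (∑ s2, pS (s1, s2) * κ (s1, s2) x) / ∑ s2, pS (s1, s2)) ≤ maxCorr pS) ∧
    (∀ s2, 0 < ∑ s1, pS (s1, s2) →
      maxCorr (fun x => (∑ s1, pS (s1, s2) * κ (s1, s2) x) / ∑ s1, pS (s1, s2)) ≤ maxCorr pS) ∧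
    (∀ s, 0 < pS s → maxCorr (κ s) ≤ maxCorr pS)}

end InputSets

/-- The joint distribution
`p(q) p(s₁,s₂,w,w₃) p(x₁,x₂|s₁,s₂,q) p(x₃|x₁,x₂,w₃,q) p(y,y₃|x₁,x₂,x₃)`. -/
def singleLetterLaw {Q S1 S2 W W3 X1 X2 X3 Y Y3 : Type*}
    (pQ : Q → ℝ) (p : S1 × S2 × W × W3 → ℝ) (κ : Q → S1 × S2 → X1 × X2 → ℝ)
    (r : Q → X1 → X2 → W3 → X3 → ℝ) (P : X1 → X2 → X3 → Y × Y3 → ℝ) :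
    Q × (S1 × S2 × W × W3) × (X1 × X2 × X3) × (Y × Y3) → ℝ :=
  fun (q, (s1, s2, w, w3), (x1, x2, x3), (y, y3)) =>
    pQ q * p (s1, s2, w, w3) * κ q (s1, s2) (x1, x2) * r q x1 x2 w3 x3 * P x1 x2 x3 (y, y3)

end MARC

end

/-!
The inclusion of the closure of `B` in `B'` is the tensorization and data-processing property of the
maximal correlation. The bound `maxCorr π ≤ ρ` is put in the form
`Cov (f(X), g(Y)) ≤ ρ (Var f(X) + Var g(Y)) / 2` for all `f`, `g` (`MARC.CorrLe`), which is closed in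
`π`, passes to independent pairs by the law of total variance (`MARC.CorrLe.prod`) and survives
separate channels (`MARC.CorrLe.channel`). Conditioning on `S₁`, on `S₂` or on both only changes the
law of the first letter, to one without correlation, and leaves the other letters i.i.d.
(`MARC.corrLe_of_mem_setB`).

The converse rests on one inequality for a block (`MARC.block_converse`). If `T` are the channel inputs,
`V = (Y, Y₃)` the outputs and `u(T)` the part of the inputs that the decoder can compute from its
(enhanced) side information `Z` and the past outputs, then
`n H(S | Z) ≤ ∑ₖ I(Tₖ ; Vₖ | u(Tₖ)) + log 2 + Pₑ n log |S|`.
It is the nonnegativity of the divergence between the true law of sources and outputs and the law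
that keeps `Z`, draws each output from its true conditional law given `u(Tₖ)` alone, and draws the
sources from a Fano-type guess.

The relay input `X₃` depends on the past outputs, hence on the whole source blocks, so the true joint
law of `(S₁, S₂, W, W₃, X₁, X₂, X₃)` at time `k` need not factor as `p(x₁,x₂|s₁,s₂) p(x₃|x₁,x₂,w₃)`.
It is replaced by the law under which the inputs keep their true joint law but are independent of
sources and side informations. This does not decrease the information terms: given the
inputs the outputs do not depend on the sources, so that conditioning on `S₁`, `S₂` or `W` can only
lower the entropy of the outputs; accordingly `MARC.block_converse` conditions on inputs only, and
`MARC.condMutualInfo_product` identifies its terms with those of the new law. The law of `(X₁, X₂)`,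
as a conditional law constant in `(s₁, s₂)`, lies in `B`, because encoders for blocks of length
`n + 1` may ignore the first letter (`MARC.const_mem_setB`).

Finally the time average of the vectors of three information terms is, by Carathéodory's theorem in
`ℝ³`, an average over four input laws. These range over a compact set on which the information is
continuous, so a limit along block lengths with vanishing error probability exists; this is where
the closure of `B` is needed (`MARC.exists_entropyVector_le`).
-/

noncomputable section

namespace MARC

/-! ### Maximal correlation: tensorization and data processing -/

/-- Quadratic form of the bound "the maximal correlation of `X` and `Y` under `μ` is at most `ρ`":
`Cov (f(X), g(Y)) ≤ ρ (Var f(X) + Var g(Y)) / 2` for all `f` and `g`. Unlike the definition by a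
supremum over normalized functions, it is a closed condition on `μ`. -/
def CorrLe {Ω α β : Type*} [Fintype Ω] (μ : Ω → ℝ) (X : Ω → α) (Y : Ω → β) (ρ : ℝ) : Prop :=
  ∀ (f : α → ℝ) (g : β → ℝ),
    ∑ ω, μ ω * (f (X ω) * g (Y ω)) - (∑ ω, μ ω * f (X ω)) * (∑ ω, μ ω * g (Y ω)) ≤
      ρ / 2 * ((∑ ω, μ ω * f (X ω) ^ 2 - (∑ ω, μ ω * f (X ω)) ^ 2) +
        (∑ ω, μ ω * g (Y ω) ^ 2 - (∑ ω, μ ω * g (Y ω)) ^ 2))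

section Correlation

variable {Ω Ω' α β α' β' : Type*} [Fintype Ω] [Fintype Ω']

lemma sum_mul_sub_mean_mul_sub_mean {μ : Ω → ℝ} (hμ : ∑ ω, μ ω = 1) (f g : Ω → ℝ) :
    ∑ ω, μ ω * ((f ω - ∑ ω, μ ω * f ω) * (g ω - ∑ ω, μ ω * g ω)) =
      ∑ ω, μ ω * (f ω * g ω) - (∑ ω, μ ω * f ω) * (∑ ω, μ ω * g ω) := by
  set a := ∑ ω, μ ω * f ω with ha
  set b := ∑ ω, μ ω * g ω with hb
  have : ∀ ω, μ ω * ((f ω - a) * (g ω - b)) =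
      μ ω * (f ω * g ω) - b * (μ ω * f ω) - a * (μ ω * g ω) + a * b * μ ω := fun ω => by ring
  simp_rw [this, Finset.sum_add_distrib, Finset.sum_sub_distrib, ← Finset.mul_sum, hμ, ← ha, ← hb]
  ring

lemma sum_mul_sub_mean_sq {μ : Ω → ℝ} (hμ : ∑ ω, μ ω = 1) (f : Ω → ℝ) :
    ∑ ω, μ ω * (f ω - ∑ ω, μ ω * f ω) ^ 2 = ∑ ω, μ ω * f ω ^ 2 - (∑ ω, μ ω * f ω) ^ 2 := by
  simpa only [← sq] using sum_mul_sub_mean_mul_sub_mean hμ f f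

lemma variance_nonneg {μ : Ω → ℝ} (hμ : μ ∈ stdSimplex ℝ Ω) (f : Ω → ℝ) :
    0 ≤ ∑ ω, μ ω * f ω ^ 2 - (∑ ω, μ ω * f ω) ^ 2 := by
  rw [← sum_mul_sub_mean_sq hμ.2]
  exact Finset.sum_nonneg fun ω _ => mul_nonneg (hμ.1 ω) (sq_nonneg _)

lemma covariance_eq_zero_of_variance_eq_zero {μ : Ω → ℝ} (hμ : μ ∈ stdSimplex ℝ Ω) (f g : Ω → ℝ)
    (hf : ∑ ω, μ ω * f ω ^ 2 - (∑ ω, μ ω * f ω) ^ 2 = 0) :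
    ∑ ω, μ ω * (f ω * g ω) - (∑ ω, μ ω * f ω) * (∑ ω, μ ω * g ω) = 0 := by
  rw [← sum_mul_sub_mean_sq hμ.2, Finset.sum_eq_zero_iff_of_nonneg
    fun ω _ => mul_nonneg (hμ.1 ω) (sq_nonneg _)] at hf
  rw [← sum_mul_sub_mean_mul_sub_mean hμ.2]
  refine Finset.sum_eq_zero fun ω hω => ?_
  rcases mul_eq_zero.1 (hf ω hω) with h | h
  · simp [h]
  · simp [pow_eq_zero_iff] at h
    simp [h]

lemma bddAbove_correlations [Fintype α] [Fintype β] {π : α × β → ℝ} (hπ : ∀ z, 0 ≤ π z) :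
    BddAbove {c : ℝ | ∃ (f : α → ℝ) (g : β → ℝ),
      ∑ z, π z * f z.1 = 0 ∧ ∑ z, π z * g z.2 = 0 ∧
      ∑ z, π z * f z.1 ^ 2 = 1 ∧ ∑ z, π z * g z.2 ^ 2 = 1 ∧
      c = ∑ z, π z * (f z.1 * g z.2)} := by
  refine ⟨1, ?_⟩
  rintro c ⟨f, g, -, -, hf, hg, rfl⟩
  have : ∑ z, π z * (f z.1 * g z.2) ≤ ∑ z, (1 / 2 * (π z * f z.1 ^ 2) + 1 / 2 * (π z * g z.2 ^ 2)) :=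
    Finset.sum_le_sum fun z _ => by nlinarith [mul_nonneg (hπ z) (sq_nonneg (f z.1 - g z.2))]
  rw [Finset.sum_add_distrib, ← Finset.mul_sum, ← Finset.mul_sum, hf, hg] at this
  linarith

lemma maxCorr_nonneg [Fintype α] [Fintype β] {π : α × β → ℝ} (hπ : ∀ z, 0 ≤ π z) :
    0 ≤ maxCorr π := by
  unfold maxCorr
  by_cases h : ∃ (f : α → ℝ) (g : β → ℝ),
      ∑ z, π z * f z.1 = 0 ∧ ∑ z, π z * g z.2 = 0 ∧
      ∑ z, π z * f z.1 ^ 2 = 1 ∧ ∑ z, π z * g z.2 ^ 2 = 1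
  · obtain ⟨f, g, h1, h2, h3, h4⟩ := h
    have a := le_csSup (bddAbove_correlations hπ) ⟨f, g, h1, h2, h3, h4, rfl⟩
    have b := le_csSup (bddAbove_correlations hπ)
      ⟨fun x => -f x, g, by simpa using h1, h2, by simpa using h3, h4, rfl⟩
    simp only [neg_mul, mul_neg, Finset.sum_neg_distrib] at b
    linarith
  · refine Real.sSup_nonneg ?_
    rintro c ⟨f, g, h1, h2, h3, h4, -⟩
    exact absurd ⟨f, g, h1, h2, h3, h4⟩ h

lemma maxCorr_le_iff [Fintype α] [Fintype β] {π : α × β → ℝ} (hπ : π ∈ stdSimplex ℝ (α × β))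
    {ρ : ℝ} (hρ : 0 ≤ ρ) : maxCorr π ≤ ρ ↔ CorrLe π Prod.fst Prod.snd ρ := by
  constructor
  · intro h f g
    have hf0 := variance_nonneg hπ fun z => f z.1
    have hg0 := variance_nonneg hπ fun z => g z.2
    rcases hf0.eq_or_lt with hf | hf
    · rw [covariance_eq_zero_of_variance_eq_zero hπ (fun z => f z.1) (fun z => g z.2) hf.symm]
      exact mul_nonneg (by linarith) (add_nonneg hf0 hg0)
    rcases hg0.eq_or_lt with hg | hg
    · have := covariance_eq_zero_of_variance_eq_zero hπ (fun z => g z.2) (fun z => f z.1) hg.symm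
      simp_rw [mul_comm (g _) (f _)] at this
      rw [mul_comm (∑ z, π z * f z.1), this]
      exact mul_nonneg (by linarith) (add_nonneg hf0 hg0)
    have hvf := sum_mul_sub_mean_sq hπ.2 fun z => f z.1
    have hvg := sum_mul_sub_mean_sq hπ.2 fun z => g z.2
    have hcov := sum_mul_sub_mean_mul_sub_mean hπ.2 (fun z => f z.1) (fun z => g z.2)
    rw [← hvf] at hf ⊢
    rw [← hvg] at hg ⊢
    rw [← hcov]
    set a := ∑ z, π z * f z.1 with ha
    set b := ∑ z, π z * g z.2 with hb
    set A := ∑ z, π z * (f z.1 - a) ^ 2 with hA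
    set B := ∑ z, π z * (g z.2 - b) ^ 2 with hB
    have hsA := Real.sqrt_pos.2 hf
    have hsB := Real.sqrt_pos.2 hg
    have key := (le_csSup (bddAbove_correlations hπ.1)
      ⟨fun x => (f x - a) / √A, fun y => (g y - b) / √B, ?_, ?_, ?_, ?_, rfl⟩).trans h
    · have e : ∑ z, π z * ((f z.1 - a) / √A * ((g z.2 - b) / √B)) =
          (∑ z, π z * ((f z.1 - a) * (g z.2 - b))) / (√A * √B) := by
        rw [Finset.sum_div]
        exact Finset.sum_congr rfl fun z _ => by field_simp
      rw [e, div_le_iff₀ (mul_pos hsA hsB)] at key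
      refine key.trans ?_
      have h2 : √A * √B ≤ (A + B) / 2 := by
        nlinarith [sq_nonneg (√A - √B), Real.sq_sqrt hf.le, Real.sq_sqrt hg.le]
      calc ρ * (√A * √B) ≤ ρ * ((A + B) / 2) := mul_le_mul_of_nonneg_left h2 hρ
        _ = _ := by ring
    · simp_rw [mul_div_assoc', ← Finset.sum_div, mul_sub, Finset.sum_sub_distrib,
        ← Finset.sum_mul, hπ.2, ← ha]
      simp
    · simp_rw [mul_div_assoc', ← Finset.sum_div, mul_sub, Finset.sum_sub_distrib,
        ← Finset.sum_mul, hπ.2, ← hb]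
      simp
    · simp_rw [div_pow, Real.sq_sqrt hf.le, mul_div_assoc', ← Finset.sum_div]
      exact div_self hf.ne'
    · simp_rw [div_pow, Real.sq_sqrt hg.le, mul_div_assoc', ← Finset.sum_div]
      exact div_self hg.ne'
  · intro h
    refine Real.sSup_le ?_ hρ
    rintro c ⟨f, g, h1, h2, h3, h4, rfl⟩
    have := h f g
    rw [h1, h2, h3, h4] at this
    linarith

/-- Adding independent pairs does not increase the bound on the maximal correlation: condition on
the first pair, apply the bound for the second one to the conditional laws, then the bound for the
first one to the conditional means; the law of total variance adds up the right-hand sides. -/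
lemma CorrLe.prod {μ : Ω → ℝ} {ν : Ω' → ℝ} {X : Ω → α} {Y : Ω → β} {X' : Ω' → α'} {Y' : Ω' → β'}
    {ρ : ℝ} (hμ : μ ∈ stdSimplex ℝ Ω) (h : CorrLe μ X Y ρ) (h' : CorrLe ν X' Y' ρ) :
    CorrLe (fun z : Ω × Ω' => μ z.1 * ν z.2) (fun z => (X z.1, X' z.2)) (fun z => (Y z.1, Y' z.2))
      ρ := by
  intro f g
  simp only [Fintype.sum_prod_type, mul_assoc]
  simp only [← Finset.mul_sum]
  have h1 := Finset.sum_le_sum fun ω (_ : ω ∈ Finset.univ) => mul_le_mul_of_nonneg_left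
    (h' (fun x' => f (X ω, x')) (fun y' => g (Y ω, y'))) (hμ.1 ω)
  have h2 := h (fun x => ∑ ω', ν ω' * f (x, X' ω')) (fun y => ∑ ω', ν ω' * g (y, Y' ω'))
  simp only [mul_sub, mul_add, Finset.sum_sub_distrib, Finset.sum_add_distrib] at h1 h2 ⊢
  simp only [mul_left_comm (μ _) (ρ / 2), ← Finset.mul_sum] at h1
  linarith

lemma CorrLe.comp {μ : Ω → ℝ} {X : Ω → α} {Y : Ω → β} {ρ : ℝ} (h : CorrLe μ X Y ρ)
    (φ : α → α') (ψ : β → β') : CorrLe μ (fun ω => φ (X ω)) (fun ω => ψ (Y ω)) ρ :=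
  fun f g => h (fun x => f (φ x)) (fun y => g (ψ y))

lemma CorrLe.of_equiv {μ : Ω → ℝ} {ν : Ω' → ℝ} {X : Ω → α} {Y : Ω → β} {X' : Ω' → α} {Y' : Ω' → β}
    {ρ : ℝ} (e : Ω' ≃ Ω) (h : CorrLe μ X Y ρ) (hν : ∀ ω, ν ω = μ (e ω)) (hX : ∀ ω, X' ω = X (e ω))
    (hY : ∀ ω, Y' ω = Y (e ω)) : CorrLe ν X' Y' ρ := by
  intro f g
  have := h f g
  simp only [← e.sum_comp] at this
  simpa only [hν, hX, hY] using this

lemma prod_mem_stdSimplex {p : Ω → ℝ} (hp : p ∈ stdSimplex ℝ Ω) (n : ℕ) :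
    (fun σ : Fin n → Ω => ∏ k, p (σ k)) ∈ stdSimplex ℝ (Fin n → Ω) := by
  refine ⟨fun σ => Finset.prod_nonneg fun k _ => hp.1 _, ?_⟩
  simpa [hp.2] using
    (Finset.prod_univ_sum (fun _ : Fin n => (Finset.univ : Finset Ω)) fun _ => p).symm

lemma CorrLe.pi {p : Ω → ℝ} {X : Ω → α} {Y : Ω → β} {ρ : ℝ}
    (hp : p ∈ stdSimplex ℝ Ω) (h : CorrLe p X Y ρ) (n : ℕ) :
    CorrLe (fun σ : Fin n → Ω => ∏ k, p (σ k)) (fun σ k => X (σ k)) (fun σ k => Y (σ k)) ρ := by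
  induction n with
  | zero =>
    intro f g
    simp
  | succ n ih =>
    refine ((h.prod hp ih).comp (fun x => (Fin.cons x.1 x.2 : Fin (n + 1) → α))
      (fun y => (Fin.cons y.1 y.2 : Fin (n + 1) → β))).of_equiv
        (Fin.consEquiv fun _ : Fin (n + 1) => Ω).symm ?_ ?_ ?_
    · intro σ
      simp [Fin.prod_univ_succ, Fin.tail]
    · intro σ
      ext k
      refine Fin.cases ?_ (fun j => ?_) k <;> simp [Fin.tail]
    · intro σ
      ext k
      refine Fin.cases ?_ (fun j => ?_) k <;> simp [Fin.tail]

lemma sq_sum_mul_le {p : Ω → ℝ} (hp : p ∈ stdSimplex ℝ Ω) (f : Ω → ℝ) :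
    (∑ x, p x * f x) ^ 2 ≤ ∑ x, p x * f x ^ 2 := by
  linarith [variance_nonneg hp f]

/-- Data processing: the maximal correlation does not increase when `X` and `Y` are passed
through separate channels. -/
lemma CorrLe.channel [Fintype α'] [Fintype β'] {μ : Ω → ℝ} {X : Ω → α} {Y : Ω → β} {ρ : ℝ}
    (hρ : 0 ≤ ρ) (hμ : ∀ ω, 0 ≤ μ ω) (h : CorrLe μ X Y ρ) {p : α → α' → ℝ} {q : β → β' → ℝ}
    (hp : ∀ a, p a ∈ stdSimplex ℝ α') (hq : ∀ b, q b ∈ stdSimplex ℝ β') :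
    CorrLe (fun z : α' × β' => ∑ ω, μ ω * (p (X ω) z.1 * q (Y ω) z.2)) Prod.fst Prod.snd ρ := by
  intro f g
  have e : ∀ (f : α' → ℝ) (g : β' → ℝ),
      ∑ z : α' × β', (∑ ω, μ ω * (p (X ω) z.1 * q (Y ω) z.2)) * (f z.1 * g z.2) =
      ∑ ω, μ ω * ((∑ a, p (X ω) a * f a) * ∑ b, q (Y ω) b * g b) := by
    intro f g
    simp_rw [Finset.sum_mul]
    rw [Finset.sum_comm]
    refine Finset.sum_congr rfl fun ω _ => ?_
    rw [Fintype.sum_prod_type, Finset.mul_sum]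
    refine Finset.sum_congr rfl fun a _ => ?_
    rw [Finset.mul_sum, Finset.mul_sum]
    exact Finset.sum_congr rfl fun b _ => by ring
  have ef : ∀ f : α' → ℝ,
      ∑ z : α' × β', (∑ ω, μ ω * (p (X ω) z.1 * q (Y ω) z.2)) * f z.1 =
      ∑ ω, μ ω * (∑ a, p (X ω) a * f a) := by
    intro f
    simpa [(hq _).2] using e f fun _ => 1
  have eg : ∀ g : β' → ℝ,
      ∑ z : α' × β', (∑ ω, μ ω * (p (X ω) z.1 * q (Y ω) z.2)) * g z.2 =
      ∑ ω, μ ω * (∑ b, q (Y ω) b * g b) := by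
    intro g
    simpa [(hp _).2] using e (fun _ => 1) g
  rw [e, ef f, eg g, ef fun x => f x ^ 2, eg fun x => g x ^ 2]
  refine (h (fun a => ∑ x, p a x * f x) (fun b => ∑ y, q b y * g y)).trans ?_
  have hf : ∑ ω, μ ω * (∑ a, p (X ω) a * f a) ^ 2 ≤ ∑ ω, μ ω * ∑ a, p (X ω) a * f a ^ 2 :=
    Finset.sum_le_sum fun ω _ => mul_le_mul_of_nonneg_left (sq_sum_mul_le (hp _) f) (hμ ω)
  have hg : ∑ ω, μ ω * (∑ b, q (Y ω) b * g b) ^ 2 ≤ ∑ ω, μ ω * ∑ b, q (Y ω) b * g b ^ 2 :=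
    Finset.sum_le_sum fun ω _ => mul_le_mul_of_nonneg_left (sq_sum_mul_le (hq _) g) (hμ ω)
  exact mul_le_mul_of_nonneg_left (by linarith) (by linarith)

end Correlation

/-! ### The closure of `B` lies in `B'` -/

section InputSets

variable {S1 S2 X1 X2 : Type*} [Fintype S1] [Fintype S2] [Fintype X1] [Fintype X2]

/-- A block of pairs is a pair of blocks. -/
lemma sum_pi_prod {α β : Type*} [Fintype α] [Fintype β] {n : ℕ}
    (F : (Fin n → α) → (Fin n → β) → ℝ) :
    ∑ t1, ∑ t2, F t1 t2 = ∑ t : Fin n → α × β, F (fun k => (t k).1) (fun k => (t k).2) := by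
  rw [← (Equiv.arrowProdEquivProdArrow (Fin n) (fun _ => α) (fun _ => β)).symm.sum_comp,
    Fintype.sum_prod_type]
  rfl

lemma isClosed_setOf_corrLe (a : S1 × S2 → ℝ) (ρ : ℝ) :
    IsClosed {κ : S1 × S2 → X1 × X2 → ℝ |
      CorrLe (fun x => ∑ s, a s * κ s x) Prod.fst Prod.snd ρ} := by
  simp only [CorrLe, Set.ofPred_forall]
  refine isClosed_iInter fun f => isClosed_iInter fun g => isClosed_le ?_ ?_ <;> fun_prop

/-- Under a law `a` of `(S₁, S₂)` that charges only pairs of positive probability, the inputs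
given by an element of `B` obey every bound on the maximal correlation that `a` and `pS` obey:
they come by separate channels from one pair with law `a` and an independent i.i.d. block. -/
lemma corrLe_of_mem_setB {pS : S1 × S2 → ℝ} (hpS : pS ∈ stdSimplex ℝ (S1 × S2)) {ρ : ℝ}
    (hρ : 0 ≤ ρ) (h : CorrLe pS Prod.fst Prod.snd ρ) {a : S1 × S2 → ℝ}
    (ha : a ∈ stdSimplex ℝ (S1 × S2)) (ha' : ∀ s, a s ≠ 0 → 0 < pS s)
    (hc : CorrLe a Prod.fst Prod.snd ρ) {κ : S1 × S2 → X1 × X2 → ℝ} (hκ : κ ∈ setB X1 X2 pS) :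
    CorrLe (fun x => ∑ s, a s * κ s x) Prod.fst Prod.snd ρ := by
  obtain ⟨-, m, p1, p2, h1, h2, hκ⟩ := hκ
  have hm := prod_mem_stdSimplex hpS m
  have := (hc.prod ha (h.pi hpS m)).channel hρ
    (fun z => mul_nonneg (ha.1 _) (hm.1 _)) (p := fun z => p1 (Fin.cons z.1 z.2))
    (q := fun z => p2 (Fin.cons z.1 z.2)) (fun _ => h1 _) (fun _ => h2 _)
  convert this using 1
  ext ⟨x1, x2⟩
  refine (Finset.sum_congr rfl fun s _ => ?_).trans (Fintype.sum_prod_type _).symm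
  by_cases hs : a s = 0
  · simp [hs]
  have hs' := ha' s hs
  rw [← Prod.eta s] at hs' ⊢
  rw [hκ x1 x2 s.1 s.2 hs', sum_pi_prod, Finset.mul_sum, Finset.mul_sum]
  refine Finset.sum_congr rfl fun t _ => ?_
  simp only [Fin.prod_univ_succ, Fin.cons_zero, Fin.cons_succ]
  field_simp

/-- A law of `(S₁, S₂)` under which one of the two is constant has no correlation. -/
lemma corrLe_of_fst_eq {a : S1 × S2 → ℝ} (ha : a ∈ stdSimplex ℝ (S1 × S2)) {ρ : ℝ} (hρ : 0 ≤ ρ)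
    {s1 : S1} (h : ∀ s, a s ≠ 0 → s.1 = s1) : CorrLe a Prod.fst Prod.snd ρ := by
  intro f g
  have hr := mul_nonneg (half_pos (zero_lt_two' ℝ)).le (mul_nonneg hρ
    (add_nonneg (variance_nonneg ha fun s => f s.1) (variance_nonneg ha fun s => g s.2)))
  have e : ∀ s, a s * f s.1 = f s1 * a s := fun s => by
    by_cases hs : a s = 0
    · simp [hs]
    · rw [h s hs, mul_comm]
  have e1 : ∑ s, a s * f s.1 = f s1 := by simp_rw [e, ← Finset.mul_sum, ha.2, mul_one]
  have e2 : ∑ s, a s * (f s.1 * g s.2) = f s1 * ∑ s, a s * g s.2 := by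
    simp_rw [← mul_assoc, e, mul_assoc, ← Finset.mul_sum]
  rw [e2]
  rw [e1] at hr ⊢
  linarith

lemma corrLe_of_snd_eq {a : S1 × S2 → ℝ} (ha : a ∈ stdSimplex ℝ (S1 × S2)) {ρ : ℝ} (hρ : 0 ≤ ρ)
    {s2 : S2} (h : ∀ s, a s ≠ 0 → s.2 = s2) : CorrLe a Prod.fst Prod.snd ρ := by
  have ha' : (fun s : S2 × S1 => a s.swap) ∈ stdSimplex ℝ (S2 × S1) :=
    ⟨fun s => ha.1 _, ((Equiv.prodComm S2 S1).sum_comp a).trans ha.2⟩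
  have := (corrLe_of_fst_eq ha' hρ (s1 := s2) fun s hs => h _ hs).of_equiv (Equiv.prodComm S1 S2)
    (ν := a) (X' := Prod.snd) (Y' := Prod.fst) (fun _ => rfl) (fun _ => rfl) (fun _ => rfl)
  intro f g
  simpa only [mul_comm, add_comm] using this g f

theorem closure_setB_subset_setB' {pS : S1 × S2 → ℝ} (hpS : pS ∈ stdSimplex ℝ (S1 × S2)) :
    closure (setB X1 X2 pS) ⊆ setB' X1 X2 pS := by
  classical
  intro κ hκ
  have hρ := maxCorr_nonneg hpS.1
  have hsimp : ∀ s, κ s ∈ stdSimplex ℝ (X1 × X2) := fun s =>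
    closure_minimal (t := {κ : S1 × S2 → X1 × X2 → ℝ | κ s ∈ stdSimplex ℝ (X1 × X2)}) (fun κ h => h.1 s)
      ((isClosed_stdSimplex ℝ _).preimage (continuous_apply s)) hκ
  have key : ∀ a : S1 × S2 → ℝ, a ∈ stdSimplex ℝ (S1 × S2) → (∀ s, a s ≠ 0 → 0 < pS s) →
      CorrLe a Prod.fst Prod.snd (maxCorr pS) →
      maxCorr (fun x => ∑ s, a s * κ s x) ≤ maxCorr pS := by
    intro a ha ha' hc
    refine (maxCorr_le_iff ⟨fun x => ?_, ?_⟩ hρ).2 (closure_minimal (fun κ h =>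
      corrLe_of_mem_setB hpS hρ ((maxCorr_le_iff hpS hρ).1 le_rfl) ha ha' hc h)
      (isClosed_setOf_corrLe a _) hκ)
    · exact Finset.sum_nonneg fun s _ => mul_nonneg (ha.1 s) ((hsimp s).1 x)
    · rw [Finset.sum_comm]
      simp_rw [← Finset.mul_sum, (hsimp _).2, mul_one, ha.2]
  refine ⟨hsimp, ?_, fun s1 hs1 => ?_, fun s2 hs2 => ?_, fun s hs => ?_⟩
  · exact key pS hpS (fun s hs => (hpS.1 s).lt_of_ne' hs) ((maxCorr_le_iff hpS hρ).1 le_rfl)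
  · have ha : (fun s : S1 × S2 => if s.1 = s1 then pS s / ∑ s2, pS (s1, s2) else 0) ∈
        stdSimplex ℝ (S1 × S2) := by
      refine ⟨fun s => ?_, ?_⟩
      · dsimp only
        split_ifs
        exacts [div_nonneg (hpS.1 _) hs1.le, le_rfl]
      · simp [Fintype.sum_prod_type_right, ← Finset.sum_div, hs1.ne']
    have := key _ ha (fun s hs => (hpS.1 s).lt_of_ne' fun h0 => hs (by simp [h0]))
      (corrLe_of_fst_eq (s1 := s1) ha hρ fun s hs => by_contra fun h0 => hs (by simp [h0]))
    convert this using 2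
    ext x
    simp [Fintype.sum_prod_type_right, Finset.sum_div, div_mul_eq_mul_div]
  · have ha : (fun s : S1 × S2 => if s.2 = s2 then pS s / ∑ s1, pS (s1, s2) else 0) ∈
        stdSimplex ℝ (S1 × S2) := by
      refine ⟨fun s => ?_, ?_⟩
      · dsimp only
        split_ifs
        exacts [div_nonneg (hpS.1 _) hs2.le, le_rfl]
      · simp [Fintype.sum_prod_type, ← Finset.sum_div, hs2.ne']
    have := key _ ha (fun s hs => (hpS.1 s).lt_of_ne' fun h0 => hs (by simp [h0]))
      (corrLe_of_snd_eq (s2 := s2) ha hρ fun s hs => by_contra fun h0 => hs (by simp [h0]))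
    convert this using 2
    ext x
    simp [Fintype.sum_prod_type, Finset.sum_div, div_mul_eq_mul_div]
  · have ha : (Pi.single s 1 : S1 × S2 → ℝ) ∈ stdSimplex ℝ (S1 × S2) :=
      single_mem_stdSimplex ℝ s
    have hne : ∀ s', (Pi.single s 1 : S1 × S2 → ℝ) s' ≠ 0 → s' = s := fun s' h0 =>
      by_contra fun hne => h0 (by simp [hne])
    have := key _ ha (fun s' h0 => hne s' h0 ▸ hs)
      (corrLe_of_fst_eq (s1 := s.1) ha hρ fun s' h0 => by rw [hne s' h0])
    convert this using 2
    ext x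
    simp [Pi.single_apply]

end InputSets

/-! ### Causal product kernels -/

section Causal

variable {V : Type*}

/-- The letters of a block before time `k`. -/
def past {n : ℕ} (v : Fin n → V) (k : Fin n) : Fin k → V :=
  fun j => v (Fin.castLE k.isLt.le j)

lemma past_snoc_castSucc {n : ℕ} (v : Fin n → V) (y : V) (k : Fin n) :
    past (Fin.snoc v y : Fin (n + 1) → V) k.castSucc = past v k := by
  ext j
  exact Fin.snoc_castSucc (α := fun _ => V) y v (Fin.castLE k.isLt.le j)

lemma past_snoc_last {n : ℕ} (v : Fin n → V) (y : V) :
    past (Fin.snoc v y : Fin (n + 1) → V) (Fin.last n) = v := by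
  ext j
  exact Fin.snoc_castSucc (α := fun _ => V) y v j

lemma prod_causal_snoc {n : ℕ} (Q : (k : Fin (n + 1)) → (Fin k → V) → V → ℝ) (v : Fin n → V)
    (y : V) :
    ∏ k, Q k (past (Fin.snoc v y : Fin (n + 1) → V) k) ((Fin.snoc v y : Fin (n + 1) → V) k) =
      (∏ k : Fin n, Q k.castSucc (past v k) (v k)) * Q (Fin.last n) v y := by
  rw [Fin.prod_univ_castSucc, past_snoc_last, Fin.snoc_last]
  congr 1
  refine Finset.prod_congr rfl fun k _ => ?_
  rw [past_snoc_castSucc, Fin.snoc_castSucc (α := fun _ => V)]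

variable [Fintype V]

lemma sum_snoc {n : ℕ} (F : (Fin (n + 1) → V) → ℝ) :
    ∑ v, F v = ∑ v : Fin n → V, ∑ y, F (Fin.snoc v y) := by
  rw [← (Fin.snocEquiv fun _ : Fin (n + 1) => V).sum_comp, Fintype.sum_prod_type_right]
  rfl

lemma sum_prod_causal_le_one {n : ℕ} (Q : (k : Fin n) → (Fin k → V) → V → ℝ)
    (h0 : ∀ k h y, 0 ≤ Q k h y) (h1 : ∀ k h, ∑ y, Q k h y ≤ 1) :
    ∑ v : Fin n → V, ∏ k, Q k (past v k) (v k) ≤ 1 := by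
  induction n with
  | zero => simp
  | succ n ih =>
    rw [sum_snoc]
    simp_rw [prod_causal_snoc, ← Finset.mul_sum]
    refine le_trans (Finset.sum_le_sum fun v _ => ?_)
      (ih (fun k => Q k.castSucc) (fun k => h0 k.castSucc) (fun k => h1 k.castSucc))
    exact mul_le_of_le_one_right (Finset.prod_nonneg fun k _ => h0 _ _ _) (h1 _ _)

lemma sum_prod_causal {n : ℕ} (Q : (k : Fin n) → (Fin k → V) → V → ℝ)
    (h1 : ∀ k h, ∑ y, Q k h y = 1) :
    ∑ v : Fin n → V, ∏ k, Q k (past v k) (v k) = 1 := by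
  induction n with
  | zero => simp
  | succ n ih =>
    rw [sum_snoc]
    simp_rw [prod_causal_snoc, ← Finset.mul_sum, h1, mul_one]
    exact ih (fun k => Q k.castSucc) (fun k => h1 k.castSucc)

/-- Given the past, the letter at time `k` has law `Q k`. -/
lemma sum_prod_causal_mul {n : ℕ} (Q : (k : Fin n) → (Fin k → V) → V → ℝ)
    (h1 : ∀ k h, ∑ y, Q k h y = 1) (k : Fin n) (f : (Fin k → V) → V → ℝ) :
    ∑ v : Fin n → V, (∏ j, Q j (past v j) (v j)) * f (past v k) (v k) =
      ∑ v : Fin n → V, (∏ j, Q j (past v j) (v j)) *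
        ∑ y, Q k (past v k) y * f (past v k) y := by
  induction n with
  | zero => exact k.elim0
  | succ n ih =>
    rw [sum_snoc, sum_snoc]
    simp_rw [prod_causal_snoc]
    induction k using Fin.lastCases with
    | last =>
      simp_rw [past_snoc_last, Fin.snoc_last, mul_assoc, ← Finset.mul_sum, ← Finset.sum_mul, h1,
        one_mul]
    | cast k =>
      have hs : ∀ (v : Fin n → V) (y : V),
          (Fin.snoc v y : Fin (n + 1) → V) k.castSucc = v k := fun v y =>
        Fin.snoc_castSucc (α := fun _ => V) y v k
      simp_rw [past_snoc_castSucc, hs, mul_right_comm _ (Q (Fin.last n) _ _), ← Finset.mul_sum, h1,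
        mul_one]
      exact ih (fun k => Q k.castSucc) (fun k => h1 k.castSucc) k f

lemma sum_prod_mul_apply {p : V → ℝ} (hp : ∑ y, p y = 1) {n : ℕ} (k : Fin n) (f : V → ℝ) :
    ∑ σ : Fin n → V, (∏ j, p (σ j)) * f (σ k) = ∑ y, p y * f y := by
  rw [sum_prod_causal_mul (fun _ _ => p) (fun _ _ => hp) k fun _ => f, ← Finset.sum_mul,
    sum_prod_causal (fun _ _ => p) fun _ _ => hp, one_mul]

end Causal

/-! ### Laws of random variables and the information of a channel -/

section Law

variable {Ω α : Type*} [Fintype Ω]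

lemma law_nonneg {μ : Ω → ℝ} (hμ : ∀ ω, 0 ≤ μ ω) (X : Ω → α) (a : α) : 0 ≤ law μ X a :=
  Finset.sum_nonneg fun ω _ => hμ ω

lemma le_law {μ : Ω → ℝ} (hμ : ∀ ω, 0 ≤ μ ω) (X : Ω → α) (ω : Ω) : μ ω ≤ law μ X (X ω) := by
  classical
  exact Finset.single_le_sum (fun ω _ => hμ ω) (by simp)

lemma sum_law_mul [Fintype α] (μ : Ω → ℝ) (X : Ω → α) (f : α → ℝ) :
    ∑ a, law μ X a * f a = ∑ ω, μ ω * f (X ω) := by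
  classical
  rw [← Finset.sum_fiberwise Finset.univ X]
  refine Finset.sum_congr rfl fun a _ => ?_
  rw [law, Finset.sum_mul]
  refine Finset.sum_congr (by congr) fun ω hω => ?_
  rw [(Finset.mem_filter.1 hω).2]

lemma law_mem_stdSimplex [Fintype α] {μ : Ω → ℝ} (hμ : μ ∈ stdSimplex ℝ Ω) (X : Ω → α) :
    law μ X ∈ stdSimplex ℝ α :=
  ⟨law_nonneg hμ.1 X, by simpa [hμ.2] using sum_law_mul μ X fun _ => 1⟩

end Law

section Info

variable {T U V : Type*} [Fintype T] [Fintype V]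

/-- The mass `Pr (u(X) = a, Y = y)` when the input `X` of the channel `P` has law `π`. -/
def outLaw (P : T → V → ℝ) (u : T → U) (π : T → ℝ) (a : U) (y : V) : ℝ :=
  law (fun t => π t * P t y) u a

lemma sum_outLaw {P : T → V → ℝ} (hP : ∀ t, ∑ y, P t y = 1) (u : T → U) (π : T → ℝ) (a : U) :
    ∑ y, outLaw P u π a y = law π u a := by
  classical
  simp_rw [outLaw, law]
  rw [Finset.sum_comm]
  simp_rw [← Finset.mul_sum, hP, mul_one]

variable [Fintype U]

/-- The information `I(X ; Y | u(X))`, in nats, between the input `X` with law `π` and the output `Y`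
of the channel `P`, written as `H(u(X), Y) - H(u(X)) - H(Y | X)`: in this form it is visibly
continuous in `π`. -/
def inputInfo (P : T → V → ℝ) (u : T → U) (π : T → ℝ) : ℝ :=
  ∑ a, ∑ y, Real.negMulLog (outLaw P u π a y) - ∑ a, Real.negMulLog (law π u a) +
    ∑ t, π t * ∑ y, P t y * Real.log (P t y)

lemma continuous_inputInfo (P : T → V → ℝ) (u : T → U) : Continuous (inputInfo P u) := by
  classical
  unfold inputInfo outLaw law
  have := Real.continuous_negMulLog
  fun_prop

lemma inputInfo_eq {P : T → V → ℝ} (hP : ∀ t, ∑ y, P t y = 1) (u : T → U) (π : T → ℝ) :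
    inputInfo P u π = ∑ t, π t * ∑ y, P t y *
      (Real.log (P t y) - Real.log (outLaw P u π (u t) y) + Real.log (law π u (u t))) := by
  have h1 : ∑ a, ∑ y, Real.negMulLog (outLaw P u π a y) =
      -∑ t, π t * ∑ y, P t y * Real.log (outLaw P u π (u t) y) := by
    rw [Finset.sum_comm]
    simp_rw [Finset.mul_sum]
    rw [Finset.sum_comm (s := (Finset.univ : Finset T)), ← Finset.sum_neg_distrib]
    refine Finset.sum_congr rfl fun y _ => ?_
    simp_rw [Real.negMulLog, neg_mul, Finset.sum_neg_distrib]
    rw [← Finset.sum_congr rfl fun t _ => mul_assoc _ _ _]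
    exact congrArg _ (sum_law_mul (fun t => π t * P t y) u
      fun a => Real.log (outLaw P u π a y))
  have h2 : ∑ a, Real.negMulLog (law π u a) = -∑ t, π t * Real.log (law π u (u t)) := by
    simp_rw [Real.negMulLog, neg_mul, Finset.sum_neg_distrib]
    exact congrArg _ (sum_law_mul π u fun a => Real.log (law π u a))
  rw [inputInfo, h1, h2]
  simp_rw [mul_add, mul_sub, Finset.sum_add_distrib, Finset.sum_sub_distrib, ← Finset.sum_mul, hP,
    one_mul, mul_add, mul_sub, Finset.sum_add_distrib, Finset.sum_sub_distrib]
  ring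

end Info

/-! ### The converse for one block -/

section Converse

variable {S T V : Type*} [Fintype S] [Fintype V] {n : ℕ}

/-- The joint mass function of an i.i.d. source block `σ` with letter law `p` and of the outputs `v`
of the memoryless channel `P`, whose input at time `k` is a function of `σ` and the past outputs. -/
def blockLaw (p : S → ℝ) (P : T → V → ℝ) (inp : (k : Fin n) → (Fin n → S) → (Fin k → V) → T)
    (ω : (Fin n → S) × (Fin n → V)) : ℝ :=
  (∏ k, p (ω.1 k)) * ∏ k, P (inp k ω.1 (past ω.2 k)) (ω.2 k)

/-- The law of the channel input at time `k`. -/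
def inputLaw (p : S → ℝ) (P : T → V → ℝ) (inp : (k : Fin n) → (Fin n → S) → (Fin k → V) → T)
    (k : Fin n) : T → ℝ :=
  law (blockLaw p P inp) fun ω => inp k ω.1 (past ω.2 k)

variable {p : S → ℝ} {P : T → V → ℝ} (inp : (k : Fin n) → (Fin n → S) → (Fin k → V) → T)

lemma blockLaw_nonneg (hp : p ∈ stdSimplex ℝ S) (hP : ∀ t, P t ∈ stdSimplex ℝ V)
    (ω : (Fin n → S) × (Fin n → V)) : 0 ≤ blockLaw p P inp ω :=
  mul_nonneg (Finset.prod_nonneg fun _ _ => hp.1 _) (Finset.prod_nonneg fun _ _ => (hP _).1 _)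

lemma sum_blockLaw_mul (hP : ∀ t, P t ∈ stdSimplex ℝ V) (f : (Fin n → S) → ℝ) :
    ∑ ω, blockLaw p P inp ω * f ω.1 = ∑ σ : Fin n → S, (∏ k, p (σ k)) * f σ := by
  rw [Fintype.sum_prod_type]
  refine Finset.sum_congr rfl fun σ _ => ?_
  simp_rw [blockLaw, mul_right_comm _ _ (f σ), ← Finset.mul_sum]
  rw [sum_prod_causal (fun k h => P (inp k σ h)) fun k h => (hP _).2, mul_one]

lemma blockLaw_mem_stdSimplex (hp : p ∈ stdSimplex ℝ S) (hP : ∀ t, P t ∈ stdSimplex ℝ V) :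
    blockLaw p P inp ∈ stdSimplex ℝ ((Fin n → S) × (Fin n → V)) := by
  refine ⟨blockLaw_nonneg inp hp hP, ?_⟩
  simpa [(prod_mem_stdSimplex hp n).2] using sum_blockLaw_mul (p := p) inp hP fun _ => 1

lemma sum_blockLaw_mul_apply (hp : p ∈ stdSimplex ℝ S) (hP : ∀ t, P t ∈ stdSimplex ℝ V)
    (k : Fin n) (f : S → ℝ) : ∑ ω, blockLaw p P inp ω * f (ω.1 k) = ∑ s, p s * f s := by
  rw [sum_blockLaw_mul inp hP fun σ => f (σ k), sum_prod_mul_apply hp.2]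

variable [Fintype T]

lemma inputLaw_mem_stdSimplex (hp : p ∈ stdSimplex ℝ S) (hP : ∀ t, P t ∈ stdSimplex ℝ V)
    (k : Fin n) : inputLaw p P inp k ∈ stdSimplex ℝ T :=
  law_mem_stdSimplex (blockLaw_mem_stdSimplex inp hp hP) _

/-- Input and output at time `k` have the joint law `inputLaw k (t) * P t y`. -/
lemma sum_blockLaw_mul_input_output (hP : ∀ t, P t ∈ stdSimplex ℝ V) (k : Fin n)
    (f : T → V → ℝ) :
    ∑ ω, blockLaw p P inp ω * f (inp k ω.1 (past ω.2 k)) (ω.2 k) =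
      ∑ t, inputLaw p P inp k t * ∑ y, P t y * f t y := by
  rw [inputLaw, sum_law_mul _ _ fun t => ∑ y, P t y * f t y, Fintype.sum_prod_type,
    Fintype.sum_prod_type]
  refine Finset.sum_congr rfl fun σ _ => ?_
  simp_rw [blockLaw, mul_assoc, ← Finset.mul_sum]
  rw [sum_prod_causal_mul (fun k h => P (inp k σ h)) (fun k h => (hP _).2) k
    fun h y => f (inp k σ h) y]

/-- The pointwise Gibbs inequality. -/
lemma sub_le_mul_log_sub_log {a b : ℝ} (ha : 0 < a) (hb : 0 < b) :
    a - b ≤ a * (Real.log a - Real.log b) := by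
  have h := Real.log_le_sub_one_of_pos (div_pos hb ha)
  rw [Real.log_div hb.ne' ha.ne'] at h
  have h2 := mul_le_mul_of_nonneg_left h ha.le
  have h3 : a * (b / a - 1) = b - a := by field_simp
  linarith

variable {Z U : Type*} [Fintype Z] [Fintype U]

/-- The single-letter converse for a block, in nats. A decoder guesses the source block `σ` from
the outputs and from `ζ(σ)`, and `err` is at least the indicator of a wrong guess; the part `u` of
the channel input is known from `ζ(σ)` and the past outputs. Then `n H(S | ζ(S))` is at most the sum
over time of the information of the channel given `u`, up to the Fano terms.

Fano's inequality, the chain rule and the single-letterization come from one application of the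
Gibbs inequality `D(μ ‖ ν) ≥ 0`: `μ` is the true law of `(σ, v)`, and `ν` gives `ζ(σ)` its true law,
draws each output from the true conditional law of the output given the known part of the input,
and then picks `σ` as the decoded block or uniformly at random, with probability `1/2` each
(guesses that do not match `ζ(σ)` are dropped, so `ν` has total mass at most `1`). -/
theorem block_converse (hp : p ∈ stdSimplex ℝ S) (hP : ∀ t, P t ∈ stdSimplex ℝ V)
    (ζ : S → Z) (u : T → U) (uz : (k : Fin n) → (Fin n → Z) → (Fin k → V) → U)
    (huz : ∀ k σ h, u (inp k σ h) = uz k (fun j => ζ (σ j)) h)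
    (dec : (Fin n → V) → (Fin n → Z) → (Fin n → S)) (err : (Fin n → S) × (Fin n → V) → ℝ)
    (herr0 : ∀ ω, 0 ≤ err ω)
    (herr1 : ∀ ω, dec ω.2 (fun j => ζ (ω.1 j)) ≠ ω.1 → 1 ≤ err ω) :
    n * ∑ s, p s * (Real.log (law p ζ (ζ s)) - Real.log (p s)) ≤
      ∑ k, inputInfo P u (inputLaw p P inp k) + Real.log 2 +
        (∑ ω, blockLaw p P inp ω * err ω) * (n * Real.log (Fintype.card S)) := by
  classical
  set μ := blockLaw p P inp with hμ
  have hμs : μ ∈ stdSimplex ℝ _ := blockLaw_mem_stdSimplex inp hp hP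
  have hpZ := law_mem_stdSimplex hp ζ
  have hS : Nonempty S := by
    by_contra h
    have := hp.2
    simp [not_nonempty_iff.1 h] at this
  set M : ℝ := (Fintype.card S : ℝ) ^ n with hM
  have hMpos : 0 < M := by positivity
  set π := inputLaw p P inp with hπ
  have hπs : ∀ k, π k ∈ stdSimplex ℝ T := inputLaw_mem_stdSimplex inp hp hP
  have hout0 : ∀ k a y, 0 ≤ outLaw P u (π k) a y := fun k a y =>
    law_nonneg (fun t => mul_nonneg ((hπs k).1 t) ((hP t).1 y)) u a
  -- `G` is the law of `ζ(σ)` and of the outputs under `ν`; the quotient is `0` when its denominator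
  -- is, so this law may have total mass less than `1`.
  set G : (Fin n → Z) → (Fin n → V) → ℝ := fun z v =>
    (∏ k, law p ζ (z k)) * ∏ k, (outLaw P u (π k) (uz k z (past v k)) (v k) /
      law (π k) u (uz k z (past v k))) with hG
  have hG0 : ∀ z v, 0 ≤ G z v := fun z v =>
    mul_nonneg (Finset.prod_nonneg fun k _ => hpZ.1 _) (Finset.prod_nonneg fun k _ =>
      div_nonneg (hout0 _ _ _) (law_nonneg (hπs k).1 _ _))
  set F : (Fin n → S) → (Fin n → S) → ℝ := fun τ σ => 1 / 2 * ((if τ = σ then 1 else 0) + 1 / M)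
    with hF
  have hF0 : ∀ τ σ, 0 < F τ σ := fun τ σ => by
    have : (0 : ℝ) ≤ if τ = σ then 1 else 0 := by split_ifs <;> simp
    simp only [hF]
    positivity
  have hF1 : ∀ τ, ∑ σ, F τ σ = 1 := fun τ => by
    simp only [hF, ← Finset.mul_sum, Finset.sum_add_distrib, Finset.sum_ite_eq, Finset.mem_univ,
      if_true, Finset.sum_const, Finset.card_univ, Fintype.card_pi, nsmul_eq_mul, Finset.prod_const,
      Fintype.card_fin, Nat.cast_pow, ← hM]
    field_simp
    norm_num
  set ν : (Fin n → S) × (Fin n → V) → ℝ := fun ω =>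
    G (fun j => ζ (ω.1 j)) ω.2 * F (dec ω.2 fun j => ζ (ω.1 j)) ω.1 with hν
  have hν1 : ∑ ω, ν ω ≤ 1 := by
    calc ∑ ω, ν ω = ∑ σ : Fin n → S, ∑ v : Fin n → V,
          G (fun j => ζ (σ j)) v * F (dec v fun j => ζ (σ j)) σ := Fintype.sum_prod_type _
      _ ≤ ∑ σ : Fin n → S, ∑ z : Fin n → Z, ∑ v : Fin n → V, G z v * F (dec v z) σ :=
          Finset.sum_le_sum fun σ _ => Finset.single_le_sum
            (f := fun z => ∑ v : Fin n → V, G z v * F (dec v z) σ)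
            (fun z _ => Finset.sum_nonneg fun v _ => mul_nonneg (hG0 _ _) (hF0 _ _).le)
            (Finset.mem_univ _)
      _ = ∑ z : Fin n → Z, ∑ v : Fin n → V, G z v := by
          rw [Finset.sum_comm]
          refine Finset.sum_congr rfl fun z _ => ?_
          rw [Finset.sum_comm]
          simp_rw [← Finset.mul_sum, hF1, mul_one]
      _ ≤ ∑ z : Fin n → Z, ∏ k, law p ζ (z k) := by
          refine Finset.sum_le_sum fun z _ => ?_
          simp only [hG, ← Finset.mul_sum]
          refine mul_le_of_le_one_right (Finset.prod_nonneg fun k _ => hpZ.1 _)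
            (sum_prod_causal_le_one (fun k h y => outLaw P u (π k) (uz k z h) y /
              law (π k) u (uz k z h)) (fun k h y => div_nonneg (hout0 _ _ _)
                (law_nonneg (hπs k).1 _ _)) fun k h => ?_)
          rw [← Finset.sum_div, sum_outLaw fun t => (hP t).2]
          exact div_self_le_one _
      _ = 1 := (prod_mem_stdSimplex hpZ n).2
  -- The logarithm of `μ / ν` at a point of positive probability, with the Fano term bounded.
  have key : ∀ ω, μ ω - ν ω ≤ μ ω *
      (∑ k, -(Real.log (law p ζ (ζ (ω.1 k))) - Real.log (p (ω.1 k))) +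
        ∑ k, (Real.log (P (inp k ω.1 (past ω.2 k)) (ω.2 k)) -
          Real.log (outLaw P u (π k) (u (inp k ω.1 (past ω.2 k))) (ω.2 k)) +
          Real.log (law (π k) u (u (inp k ω.1 (past ω.2 k))))) + Real.log 2 +
        err ω * (n * Real.log (Fintype.card S))) := by
    intro ω
    rcases (hμs.1 ω).eq_or_lt with h0 | h0
    · rw [← h0, zero_mul, zero_sub, neg_nonpos]
      exact mul_nonneg (hG0 _ _) (hF0 _ _).le
    have hne := h0.ne'
    rw [hμ, blockLaw, mul_ne_zero_iff, Finset.prod_ne_zero_iff, Finset.prod_ne_zero_iff] at hne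
    have hpp : ∀ k, 0 < p (ω.1 k) := fun k => (hp.1 _).lt_of_ne' (hne.1 k (Finset.mem_univ _))
    have hPp : ∀ k, 0 < P (inp k ω.1 (past ω.2 k)) (ω.2 k) := fun k =>
      ((hP _).1 _).lt_of_ne' (hne.2 k (Finset.mem_univ _))
    have hZp : ∀ k, 0 < law p ζ (ζ (ω.1 k)) := fun k => (hpp k).trans_le (le_law hp.1 ζ _)
    have hπp : ∀ k, 0 < π k (inp k ω.1 (past ω.2 k)) := fun k =>
      h0.trans_le (le_law hμs.1 (fun ω => inp k ω.1 (past ω.2 k)) ω)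
    have hUp : ∀ k, 0 < law (π k) u (u (inp k ω.1 (past ω.2 k))) := fun k =>
      (hπp k).trans_le (le_law (hπs k).1 u _)
    have hOp : ∀ k, 0 < outLaw P u (π k) (u (inp k ω.1 (past ω.2 k))) (ω.2 k) := fun k =>
      (mul_pos (hπp k) (hPp k)).trans_le (le_law (μ := fun t => π k t * P t (ω.2 k))
        (fun t => mul_nonneg ((hπs k).1 t) ((hP t).1 _)) u _)
    have hνe : ν ω = ((∏ k, law p ζ (ζ (ω.1 k))) *
        ∏ k, (outLaw P u (π k) (u (inp k ω.1 (past ω.2 k))) (ω.2 k) /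
          law (π k) u (u (inp k ω.1 (past ω.2 k))))) *
        F (dec ω.2 fun j => ζ (ω.1 j)) ω.1 := by
      simp only [hν, hG, huz]
    have hA : 0 < ∏ k, law p ζ (ζ (ω.1 k)) := Finset.prod_pos fun k _ => hZp k
    have hB : 0 < ∏ k, (outLaw P u (π k) (u (inp k ω.1 (past ω.2 k))) (ω.2 k) /
          law (π k) u (u (inp k ω.1 (past ω.2 k)))) :=
      Finset.prod_pos fun k _ => div_pos (hOp k) (hUp k)
    have hFl : -Real.log (F (dec ω.2 fun j => ζ (ω.1 j)) ω.1) ≤ Real.log 2 +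
        err ω * (n * Real.log (Fintype.card S)) := by
      have hL0 : 0 ≤ Real.log M := by
        rw [hM, Real.log_pow]
        exact mul_nonneg n.cast_nonneg (Real.log_natCast_nonneg _)
      rw [← Real.log_inv, ← Real.log_pow, ← hM]
      by_cases hd : dec ω.2 (fun j => ζ (ω.1 j)) = ω.1
      · refine le_add_of_le_of_nonneg ?_ (mul_nonneg (herr0 ω) hL0)
        simp only [hF, hd, if_true]
        refine Real.log_le_log (by positivity) (inv_le_of_inv_le₀ two_pos ?_)
        have : 0 < 1 / M := by positivity
        linarith
      · refine le_trans ?_ (add_le_add le_rfl (le_mul_of_one_le_left hL0 (herr1 ω hd)))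
        simp only [hF, hd, if_false, zero_add]
        rw [← Real.log_mul two_ne_zero hMpos.ne']
        exact (congrArg Real.log (by field_simp)).le
    refine (sub_le_mul_log_sub_log h0 (hνe ▸ mul_pos (mul_pos hA hB) (hF0 _ _))).trans
      (mul_le_mul_of_nonneg_left ?_ h0.le)
    rw [hνe, Real.log_mul (mul_pos hA hB).ne' (hF0 _ _).ne', Real.log_mul hA.ne' hB.ne', hμ,
      blockLaw, Real.log_mul (Finset.prod_ne_zero_iff.2 hne.1) (Finset.prod_ne_zero_iff.2 hne.2),
      Real.log_prod fun k _ => (hpp k).ne', Real.log_prod fun k _ => (hPp k).ne',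
      Real.log_prod fun k _ => (hZp k).ne', Real.log_prod fun k _ => (div_pos (hOp k) (hUp k)).ne']
    simp_rw [fun k => Real.log_div (hOp k).ne' (hUp k).ne']
    simp only [Finset.sum_add_distrib, Finset.sum_sub_distrib, Finset.sum_neg_distrib]
    linarith
  have hsum := Finset.sum_le_sum fun ω (_ : ω ∈ Finset.univ) => key ω
  have hlin : ∀ (A B E : (Fin n → S) × (Fin n → V) → ℝ) (c L : ℝ),
      ∑ ω, μ ω * (A ω + B ω + c + E ω * L) =
        ∑ ω, μ ω * A ω + ∑ ω, μ ω * B ω + c + (∑ ω, μ ω * E ω) * L := fun A B E c L => by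
    simp only [mul_add, Finset.sum_add_distrib, ← mul_assoc, ← Finset.sum_mul, hμs.2, one_mul]
  have e1 : ∑ ω, μ ω * ∑ k, -(Real.log (law p ζ (ζ (ω.1 k))) - Real.log (p (ω.1 k))) =
      -(n * ∑ s, p s * (Real.log (law p ζ (ζ s)) - Real.log (p s))) := by
    calc _ = ∑ k, ∑ ω, μ ω * -(Real.log (law p ζ (ζ (ω.1 k))) - Real.log (p (ω.1 k))) := by
          simp_rw [Finset.mul_sum]
          exact Finset.sum_comm
      _ = ∑ k : Fin n, -∑ s, p s * (Real.log (law p ζ (ζ s)) - Real.log (p s)) :=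
          Finset.sum_congr rfl fun k _ => (sum_blockLaw_mul_apply inp hp hP k
            fun s => -(Real.log (law p ζ (ζ s)) - Real.log (p s))).trans
              (by simp_rw [mul_neg, Finset.sum_neg_distrib])
      _ = _ := by simp
  have e2 : ∑ ω, μ ω * ∑ k, (Real.log (P (inp k ω.1 (past ω.2 k)) (ω.2 k)) -
          Real.log (outLaw P u (π k) (u (inp k ω.1 (past ω.2 k))) (ω.2 k)) +
          Real.log (law (π k) u (u (inp k ω.1 (past ω.2 k))))) =
      ∑ k, inputInfo P u (π k) := by
    simp_rw [Finset.mul_sum]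
    rw [Finset.sum_comm]
    refine Finset.sum_congr rfl fun k _ => ?_
    rw [inputInfo_eq fun t => (hP t).2]
    exact sum_blockLaw_mul_input_output inp hP k fun t y => Real.log (P t y) -
      Real.log (outLaw P u (π k) (u t) y) + Real.log (law (π k) u (u t))
  rw [Finset.sum_sub_distrib, hμs.2, hlin, e1, e2] at hsum
  linarith

end Converse

/-! ### Conditional entropies and the single-letter information -/

section SingleLetter

variable {Ω α β γ : Type*} [Fintype Ω]

lemma law_apply_of_injective (μ : Ω → ℝ) {X : Ω → α} (hX : Function.Injective X) (ω : Ω) :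
    law μ X (X ω) = μ ω := by
  classical
  rw [law, Finset.sum_filter]
  simp [hX.eq_iff]

variable [Fintype α] [Fintype γ]

lemma condEntropy_eq (μ : Ω → ℝ) (X : Ω → α) (Z : Ω → γ) :
    condEntropy μ X Z = -∑ ω, μ ω *
      Real.logb 2 (law μ (fun ω => (X ω, Z ω)) (X ω, Z ω) / law μ Z (Z ω)) := by
  rw [condEntropy, ← sum_law_mul μ (fun ω => (X ω, Z ω)) fun a =>
    Real.logb 2 (law μ (fun ω => (X ω, Z ω)) a / law μ Z a.2), Fintype.sum_prod_type]

lemma condMutualInfo_eq [Fintype β] (μ : Ω → ℝ) (X : Ω → α) (Y : Ω → β) (Z : Ω → γ) :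
    condMutualInfo μ X Y Z = ∑ ω, μ ω *
      Real.logb 2 (law μ (fun ω => (X ω, Y ω, Z ω)) (X ω, Y ω, Z ω) * law μ Z (Z ω) /
        (law μ (fun ω => (X ω, Z ω)) (X ω, Z ω) * law μ (fun ω => (Y ω, Z ω)) (Y ω, Z ω))) := by
  rw [condMutualInfo, ← sum_law_mul μ (fun ω => (X ω, Y ω, Z ω)) fun a =>
    Real.logb 2 (law μ (fun ω => (X ω, Y ω, Z ω)) a * law μ Z a.2.2 /
      (law μ (fun ω => (X ω, Z ω)) (a.1, a.2.2) * law μ (fun ω => (Y ω, Z ω)) a.2)),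
    Fintype.sum_prod_type]
  simp_rw [Fintype.sum_prod_type]

/-- The conditional entropy of `X` given `Z`, when the two together determine the outcome. -/
lemma condEntropy_eq_of_injective {μ : Ω → ℝ} (hμ : ∀ ω, 0 ≤ μ ω) (X : Ω → α) (Z : Ω → γ)
    (h : Function.Injective fun ω => (X ω, Z ω)) :
    condEntropy μ X Z =
      (∑ ω, μ ω * (Real.log (law μ Z (Z ω)) - Real.log (μ ω))) / Real.log 2 := by
  rw [condEntropy_eq, ← Finset.sum_neg_distrib, Finset.sum_div]
  refine Finset.sum_congr rfl fun ω _ => ?_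
  rw [law_apply_of_injective μ h]
  rcases (hμ ω).eq_or_lt with h0 | h0
  · simp [← h0]
  · rw [Real.logb, Real.log_div h0.ne' (h0.trans_le (le_law hμ Z ω)).ne']
    ring

variable {Q S T U V δ : Type*} [Fintype Q] [Fintype S] [Fintype T] [Fintype U] [Fintype V]
  {μ : Q × S × T × V → ℝ} {pQ : Q → ℝ} {p : S → ℝ} {π : Q → T → ℝ} {P : T → V → ℝ}

/-- If the sources are independent of `Q` and of the channel, an event that fixes `q` and `b(s)` has
the probability that these have, times the probability of its channel part given `q`. -/
lemma law_product (hμ : ∀ q s t y, μ (q, s, t, y) = pQ q * p s * π q t * P t y) (b : S → β)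
    (R : Q × S × T × V → δ) (q₀ : Q) (s₀ : S) (d : δ) (C : T → V → Prop)
    [∀ t y, Decidable (C t y)]
    (hR : ∀ q s t y, R (q, s, t, y) = d ↔ q = q₀ ∧ b s = b s₀ ∧ C t y) :
    law μ R d =
      pQ q₀ * law p b (b s₀) * ∑ t, ∑ y, if C t y then π q₀ t * P t y else 0 := by
  classical
  have e : ∀ q s t y, (if R (q, s, t, y) = d then μ (q, s, t, y) else 0) =
      (if q = q₀ then pQ q₀ else 0) * ((if b s = b s₀ then p s else 0) *
        if C t y then π q₀ t * P t y else 0) := by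
    intro q s t y
    rw [hμ]
    simp only [hR]
    by_cases h1 : q = q₀
    · subst h1
      by_cases h2 : b s = b s₀ <;> by_cases h3 : C t y <;> simp [h2, h3]
      ring
    · simp [h1]
  rw [law, Finset.sum_filter]
  simp_rw [Fintype.sum_prod_type, e, ← Finset.mul_sum, ← Finset.sum_mul]
  simp only [Finset.sum_ite_eq', Finset.mem_univ, if_true]
  rw [law, Finset.sum_filter, mul_assoc]

/-- When the sources are independent of `Q` and of the inputs, knowing `b(s)` does not matter, and
the information between `X` and the output given `u`, `b(s)` and `Q` is the average over `Q`
of the information of the channel given `u`. -/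
lemma condMutualInfo_product
    (hμ : ∀ q s t y, μ (q, s, t, y) = pQ q * p s * π q t * P t y)
    (hQ : ∀ q, 0 ≤ pQ q) (hp : p ∈ stdSimplex ℝ S) (hπ : ∀ q t, 0 ≤ π q t)
    (hP : ∀ t, P t ∈ stdSimplex ℝ V)
    {X : Q × S × T × V → α} {Z : Q × S × T × V → γ} {x : T → α} {b : S → β} {u : T → U}
    (hX : ∀ q s t y, X (q, s, t, y) = x t)
    (hZ : ∀ q s t y q' s' t' y', Z (q, s, t, y) = Z (q', s', t', y') ↔
      q = q' ∧ b s = b s' ∧ u t = u t')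
    (hinj : ∀ t t', x t = x t' → u t = u t' → t = t') :
    condMutualInfo μ X (fun ω => ω.2.2.2) Z =
      (∑ q, pQ q * inputInfo P u (π q)) / Real.log 2 := by
  classical
  have e : ∀ q s t y, μ (q, s, t, y) * Real.logb 2
      (law μ (fun ω => (X ω, ω.2.2.2, Z ω)) (X (q, s, t, y), y, Z (q, s, t, y)) *
        law μ Z (Z (q, s, t, y)) /
        (law μ (fun ω => (X ω, Z ω)) (X (q, s, t, y), Z (q, s, t, y)) *
          law μ (fun ω => (ω.2.2.2, Z ω)) (y, Z (q, s, t, y)))) =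
      pQ q * (p s * (π q t * (P t y * (Real.log (P t y) - Real.log (outLaw P u (π q) (u t) y) +
        Real.log (law (π q) u (u t)))))) / Real.log 2 := by
    intro q s t y
    rw [hμ]
    by_cases h0 : pQ q * p s * π q t * P t y = 0
    · rw [h0, zero_mul, eq_comm, div_eq_zero_iff]
      left
      calc _ = pQ q * p s * π q t * P t y * (Real.log (P t y) -
            Real.log (outLaw P u (π q) (u t) y) + Real.log (law (π q) u (u t))) := by ring
        _ = 0 := by rw [h0, zero_mul]
    simp only [mul_ne_zero_iff] at h0
    obtain ⟨⟨⟨h1, h2⟩, h3⟩, h4⟩ := h0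
    have hPp := ((hP t).1 y).lt_of_ne' h4
    have hπp := (hπ q t).lt_of_ne' h3
    have hpp := (hp.1 s).lt_of_ne' h2
    have hU := hπp.trans_le (le_law (hπ q) u t)
    have hO : 0 < outLaw P u (π q) (u t) y := (mul_pos hπp hPp).trans_le
      (le_law (μ := fun t => π q t * P t y) (fun t => mul_nonneg (hπ q t) ((hP t).1 _)) u t)
    have hb := hpp.trans_le (le_law hp.1 b s)
    have hq := (hQ q).lt_of_ne' h1
    rw [law_product hμ b (fun ω => (X ω, ω.2.2.2, Z ω)) q s _ (fun t' y' => t' = t ∧ y' = y),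
      law_product hμ b Z q s _ (fun t' _ => u t' = u t),
      law_product hμ b (fun ω => (X ω, Z ω)) q s _ (fun t' _ => t' = t),
      law_product hμ b (fun ω => (ω.2.2.2, Z ω)) q s _ (fun t' y' => y' = y ∧ u t' = u t)]
    · have e1 : (∑ t', ∑ y', if t' = t ∧ y' = y then π q t' * P t' y' else 0) = π q t * P t y := by
        simp [ite_and]
      have e2 : (∑ t', ∑ y', if u t' = u t then π q t' * P t' y' else 0) =
          law (π q) u (u t) := by
        rw [law, Finset.sum_filter]
        refine Finset.sum_congr rfl fun t' _ => ?_
        split_ifs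
        · rw [← Finset.mul_sum, (hP t').2, mul_one]
        · simp
      have e3 : (∑ t', ∑ y', if t' = t then π q t' * P t' y' else 0) = π q t := by
        rw [Finset.sum_comm]
        simp [← Finset.mul_sum, (hP t).2]
      have e4 : (∑ t', ∑ y', if y' = y ∧ u t' = u t then π q t' * P t' y' else 0) =
          outLaw P u (π q) (u t) y := by
        rw [outLaw, law, Finset.sum_filter]
        simp [ite_and]
      rw [e1, e2, e3, e4]
      have hr : pQ q * law p b (b s) * (π q t * P t y) *
          (pQ q * law p b (b s) * law (π q) u (u t)) /
          (pQ q * law p b (b s) * π q t *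
            (pQ q * law p b (b s) * outLaw P u (π q) (u t) y)) =
          P t y / outLaw P u (π q) (u t) y * law (π q) u (u t) := by
        field_simp
      rw [hr, Real.logb, Real.log_mul (div_pos hPp hO).ne' hU.ne', Real.log_div hPp.ne' hO.ne']
      ring
    · intro q' s' t' y'
      simp only [Prod.mk.injEq, hZ]
      tauto
    · intro q' s' t' y'
      simp only [Prod.mk.injEq, hZ, hX]
      constructor
      · rintro ⟨h1, h2, h3, h4⟩
        exact ⟨h2, h3, hinj _ _ h1 h4⟩
      · rintro ⟨h1, h2, rfl⟩
        exact ⟨rfl, h1, h2, rfl⟩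
    · intro q' s' t' y'
      exact hZ ..
    · intro q' s' t' y'
      simp only [Prod.mk.injEq, hZ, hX]
      constructor
      · rintro ⟨h1, h2, h3, h4, h5⟩
        exact ⟨h3, h4, hinj _ _ h1 h5, h2⟩
      · rintro ⟨h1, h2, rfl, rfl⟩
        exact ⟨rfl, rfl, h1, h2, rfl⟩
  rw [condMutualInfo_eq]
  simp_rw [Fintype.sum_prod_type, e, ← Finset.sum_div, ← Finset.mul_sum, ← Finset.sum_mul, hp.2,
    one_mul, inputInfo_eq (fun t => (hP t).2)]

end SingleLetter

/-! ### Laws of codeword letters -/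

section Letters

/-- Letterwise functions of an i.i.d. block form an i.i.d. block. -/
lemma law_pi {S β : Type*} [Fintype S] (p : S → ℝ) (g : S → β) {n : ℕ} (t : Fin n → β) :
    law (fun σ : Fin n → S => ∏ k, p (σ k)) (fun σ k => g (σ k)) t = ∏ k, law p g (t k) := by
  classical
  simp only [law]
  rw [Finset.prod_univ_sum]
  refine Finset.sum_congr ?_ fun _ _ => rfl
  ext σ
  simp [funext_iff]

variable {S1 S2 X1 X2 : Type*} [Fintype S1] [Fintype S2] [Fintype X1] [Fintype X2]

open Classical in
/-- Inputs that are functions of source blocks of length `n` give, independently of the current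
source pair, an element of `B`: let the encoders ignore the first letters of blocks of length
`n + 1`. -/
lemma const_mem_setB {pS : S1 × S2 → ℝ} {n : ℕ} (e1 : (Fin n → S1) → X1) (e2 : (Fin n → S2) → X2)
    {κ : X1 × X2 → ℝ} (hκ : κ ∈ stdSimplex ℝ (X1 × X2))
    (h : ∀ x1 x2, κ (x1, x2) = ∑ t : Fin n → S1 × S2, (∏ k, pS (t k)) *
      if e1 (fun k => (t k).1) = x1 ∧ e2 (fun k => (t k).2) = x2 then 1 else 0) :
    (fun _ => κ) ∈ setB X1 X2 pS := by
  refine ⟨fun _ => hκ, n, fun t => Pi.single (e1 (Fin.tail t)) 1,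
    fun t => Pi.single (e2 (Fin.tail t)) 1, fun _ => single_mem_stdSimplex ℝ _,
    fun _ => single_mem_stdSimplex ℝ _, fun x1 x2 s1 s2 hs => ?_⟩
  dsimp only
  rw [h, sum_pi_prod, Finset.mul_sum]
  refine Finset.sum_congr rfl fun t _ => ?_
  simp only [Fin.prod_univ_succ, Fin.cons_zero, Fin.cons_succ, Fin.tail_cons, Pi.single_apply,
    ite_and, eq_comm (a := x1), eq_comm (a := x2)]
  split_ifs <;> simp
  field_simp

end Letters

/-! ### Carathéodory's theorem with a fixed number of points -/

lemma exists_sum_smul_eq_of_mem_convexHull {d : ℕ} {s : Set (Fin d → ℝ)} {x : Fin d → ℝ}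
    (hx : x ∈ convexHull ℝ s) :
    ∃ w ∈ stdSimplex ℝ (Fin (d + 1)), ∃ z : Fin (d + 1) → Fin d → ℝ,
      (∀ q, z q ∈ s) ∧ ∑ q, w q • z q = x := by
  obtain ⟨x₀, hx₀⟩ : s.Nonempty := convexHull_nonempty_iff.1 ⟨x, hx⟩
  obtain ⟨ι, _, z, w, hz, hind, hw, hw1, hwz⟩ := eq_pos_convex_span_of_mem_convexHull hx
  have hcard : Fintype.card ι ≤ Fintype.card (Fin (d + 1)) := by
    rw [Fintype.card_fin]
    refine hind.card_le_finrank_succ.trans (Nat.succ_le_succ ?_)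
    simpa using Submodule.finrank_le (vectorSpan ℝ (Set.range z))
  obtain ⟨e⟩ := Function.Embedding.nonempty_of_card_le hcard
  have h0 : ∀ q ∉ Set.range e, Function.extend e w 0 q = 0 := fun q hq =>
    Function.extend_apply' _ _ _ hq
  refine ⟨Function.extend e w 0, ⟨fun q => ?_, ?_⟩, Function.extend e z fun _ => x₀, fun q => ?_, ?_⟩
  · by_cases hq : q ∈ Set.range e
    · obtain ⟨i, rfl⟩ := hq
      rw [e.injective.extend_apply]
      exact (hw i).le
    · rw [h0 q hq]
  · rw [← hw1]
    exact (Fintype.sum_of_injective e e.injective _ _ h0 fun i =>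
      (e.injective.extend_apply w 0 i).symm).symm
  · by_cases hq : q ∈ Set.range e
    · obtain ⟨i, rfl⟩ := hq
      rw [e.injective.extend_apply]
      exact hz ⟨i, rfl⟩
    · rwa [Function.extend_apply' _ _ _ hq]
  · rw [← hwz]
    exact (Fintype.sum_of_injective e e.injective _ _ (fun q hq => by rw [h0 q hq, zero_smul])
      fun i => by rw [e.injective.extend_apply, e.injective.extend_apply]).symm

/-! ### Codes for the relay channel -/

section Codes

variable {S1 S2 W W3 X1 X2 X3 Y Y3 : Type*}

/-- The channel with its three inputs as one letter. -/
def jointChannel (P : X1 → X2 → X3 → Y × Y3 → ℝ) (t : X1 × X2 × X3) : Y × Y3 → ℝ :=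
  P t.1 t.2.1 t.2.2

/-- The three channel inputs at time `k`, as a function of the source block and of the past
outputs. -/
def Code.input {n : ℕ} (c : Code S1 S2 W W3 X1 X2 X3 Y Y3 n) (k : Fin n)
    (σ : Fin n → S1 × S2 × W × W3) (h : Fin k → Y × Y3) : X1 × X2 × X3 :=
  (c.enc1 (fun j => (σ j).1) k, c.enc2 (fun j => (σ j).2.1) k,
    c.relay k (fun j => (h j).2) fun j => (σ j).2.2.2)

variable [Fintype S1] [Fintype S2] [Fintype W] [Fintype W3] [Fintype Y] [Fintype Y3]

open Classical in
lemma Code.errorProb_eq {n : ℕ} (c : Code S1 S2 W W3 X1 X2 X3 Y Y3 n)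
    (p : S1 × S2 × W × W3 → ℝ) (P : X1 → X2 → X3 → Y × Y3 → ℝ) :
    c.errorProb p P = ∑ ω, blockLaw p (jointChannel P) c.input ω *
      if c.dec (fun j => (ω.2 j).1) (fun j => (ω.1 j).2.2.1) ≠
        (fun j => (ω.1 j).1, fun j => (ω.1 j).2.1) then 1 else 0 := by
  have h4 : ∀ F : (Fin n → S1) → (Fin n → S2) → (Fin n → W) → (Fin n → W3) → ℝ,
      ∑ s1, ∑ s2, ∑ w, ∑ w3, F s1 s2 w w3 = ∑ σ : Fin n → S1 × S2 × W × W3,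
        F (fun j => (σ j).1) (fun j => (σ j).2.1) (fun j => (σ j).2.2.1)
          (fun j => (σ j).2.2.2) := fun F => by
    rw [← sum_pi_prod fun s1 (r : Fin n → S2 × W × W3) =>
      F s1 (fun j => (r j).1) (fun j => (r j).2.1) (fun j => (r j).2.2)]
    refine Finset.sum_congr rfl fun s1 _ => ?_
    rw [← sum_pi_prod fun s2 (r : Fin n → W × W3) =>
      F s1 s2 (fun j => (r j).1) (fun j => (r j).2)]
    exact Finset.sum_congr rfl fun s2 _ => sum_pi_prod (F s1 s2)
  rw [Code.errorProb, h4, Fintype.sum_prod_type]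
  refine Finset.sum_congr rfl fun σ _ => ?_
  rw [sum_pi_prod]
  refine Finset.sum_congr rfl fun v _ => ?_
  rw [mul_ite, mul_one, mul_zero]
  rfl

variable [Fintype X1] [Fintype X2] [Fintype X3]

/-- The joint laws of the three channel inputs for which the law of `(X₁, X₂)`, taken as a conditional
law that does not depend on the sources, is in the closure of `B`. -/
def inputLaws (p : S1 × S2 × W × W3 → ℝ) : Set (X1 × X2 × X3 → ℝ) :=
  {π | π ∈ stdSimplex ℝ (X1 × X2 × X3) ∧
    (fun _ x => ∑ x3, π (x.1, x.2, x3)) ∈ closure (setB X1 X2 (sourcePair p))}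

lemma isCompact_inputLaws (p : S1 × S2 × W × W3 → ℝ) :
    IsCompact (inputLaws (X1 := X1) (X2 := X2) (X3 := X3) p) :=
  (isCompact_stdSimplex ℝ _).inter_right (isClosed_closure.preimage
    (f := fun (π : X1 × X2 × X3 → ℝ) (_ : S1 × S2) (x : X1 × X2) => ∑ x3, π (x.1, x.2, x3))
    (by fun_prop))

lemma marginal_mem_stdSimplex {π : X1 × X2 × X3 → ℝ} (hπ : π ∈ stdSimplex ℝ (X1 × X2 × X3)) :
    (fun x : X1 × X2 => ∑ x3, π (x.1, x.2, x3)) ∈ stdSimplex ℝ (X1 × X2) :=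
  ⟨fun x => Finset.sum_nonneg fun x3 _ => hπ.1 _, by
    rw [← hπ.2]
    simp_rw [Fintype.sum_prod_type]⟩

lemma Code.inputLaw_mem_inputLaws {p : S1 × S2 × W × W3 → ℝ}
    (hp : p ∈ stdSimplex ℝ (S1 × S2 × W × W3)) {P : X1 → X2 → X3 → Y × Y3 → ℝ}
    (hP : ∀ x1 x2 x3, P x1 x2 x3 ∈ stdSimplex ℝ (Y × Y3)) {n : ℕ}
    (c : Code S1 S2 W W3 X1 X2 X3 Y Y3 n) (k : Fin n) :
    inputLaw p (jointChannel P) c.input k ∈ inputLaws p := by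
  classical
  have hπ := inputLaw_mem_stdSimplex (P := jointChannel P) c.input hp (fun t => hP _ _ _) k
  refine ⟨hπ, subset_closure (const_mem_setB (fun s => c.enc1 s k) (fun s => c.enc2 s k)
    (marginal_mem_stdSimplex hπ) fun x1 x2 => ?_)⟩
  have h1 : ∑ x3, inputLaw p (jointChannel P) c.input k (x1, x2, x3) =
      ∑ t, inputLaw p (jointChannel P) c.input k t *
        if t.1 = x1 ∧ t.2.1 = x2 then 1 else 0 := by
    rw [Fintype.sum_prod_type, Finset.sum_eq_single x1 (by simp +contextual) (by simp),
      Fintype.sum_prod_type, Finset.sum_eq_single x2 (by simp +contextual) (by simp)]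
    simp
  dsimp only
  rw [h1, inputLaw, sum_law_mul _ _ fun t : X1 × X2 × X3 =>
    if t.1 = x1 ∧ t.2.1 = x2 then (1 : ℝ) else 0]
  refine (sum_blockLaw_mul (P := jointChannel P) c.input (fun t => hP _ _ _) fun σ =>
    if c.enc1 (fun j => (σ j).1) k = x1 ∧ c.enc2 (fun j => (σ j).2.1) k = x2 then 1
    else 0).trans ?_
  simp_rw [sourcePair, ← law_pi]
  rw [sum_law_mul]

/-- The three information terms of the converse, in nats: about `X₁` given `(X₂, X₃)`, about `X₂`
given `(X₁, X₃)`, and about `(X₁, X₂)` given `X₃`. -/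
def infoVector (P : X1 → X2 → X3 → Y × Y3 → ℝ) (π : X1 × X2 × X3 → ℝ) : Fin 3 → ℝ :=
  ![inputInfo (jointChannel P) (fun t => (t.2.1, t.2.2)) π,
    inputInfo (jointChannel P) (fun t => (t.1, t.2.2)) π,
    inputInfo (jointChannel P) (fun t => t.2.2) π]

lemma continuous_infoVector (P : X1 → X2 → X3 → Y × Y3 → ℝ) : Continuous (infoVector P) := by
  refine continuous_pi fun i => ?_
  fin_cases i <;> exact continuous_inputInfo _ _

/-- The entropy, in nats, of a letter with law `p` given its function `ζ`. -/
def entropyGiven {S Z : Type*} [Fintype S] (p : S → ℝ) (ζ : S → Z) : ℝ :=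
  ∑ s, p s * (Real.log (law p ζ (ζ s)) - Real.log (p s))

/-- The three source entropies of the converse, in nats. -/
def entropyVector (p : S1 × S2 × W × W3 → ℝ) : Fin 3 → ℝ :=
  ![entropyGiven p fun s => (s.2.1, s.2.2.1, s.2.2.2),
    entropyGiven p fun s => (s.1, s.2.2.1, s.2.2.2),
    entropyGiven p fun s => (s.2.2.1, s.2.2.2)]

/-- The converse for one block: a decoder that is also given `y₃` and `w₃`, and in the first two cases
one of the two sources, recovers what is left of the sources unless the code makes an error. -/
lemma Code.entropyVector_le {p : S1 × S2 × W × W3 → ℝ}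
    (hp : p ∈ stdSimplex ℝ (S1 × S2 × W × W3)) {P : X1 → X2 → X3 → Y × Y3 → ℝ}
    (hP : ∀ x1 x2 x3, P x1 x2 x3 ∈ stdSimplex ℝ (Y × Y3)) {n : ℕ}
    (c : Code S1 S2 W W3 X1 X2 X3 Y Y3 n) (i : Fin 3) :
    n * entropyVector p i ≤
      ∑ k, infoVector P (inputLaw p (jointChannel P) c.input k) i + Real.log 2 +
        c.errorProb p P * (n * Real.log (Fintype.card (S1 × S2 × W × W3))) := by
  classical
  have hP' : ∀ t, jointChannel P t ∈ stdSimplex ℝ (Y × Y3) := fun t => hP _ _ _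
  rw [c.errorProb_eq]
  have herr0 : ∀ ω : (Fin n → S1 × S2 × W × W3) × (Fin n → Y × Y3), (0 : ℝ) ≤
      if c.dec (fun j => (ω.2 j).1) (fun j => (ω.1 j).2.2.1) ≠
        (fun j => (ω.1 j).1, fun j => (ω.1 j).2.1) then 1 else 0 := fun ω => by
    split_ifs <;> norm_num
  have herr1 : ∀ ω : (Fin n → S1 × S2 × W × W3) × (Fin n → Y × Y3),
      c.dec (fun j => (ω.2 j).1) (fun j => (ω.1 j).2.2.1) ≠
        (fun j => (ω.1 j).1, fun j => (ω.1 j).2.1) → (1 : ℝ) ≤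
      if c.dec (fun j => (ω.2 j).1) (fun j => (ω.1 j).2.2.1) ≠
        (fun j => (ω.1 j).1, fun j => (ω.1 j).2.1) then 1 else 0 := fun ω h => by
    rw [if_pos h]
  fin_cases i
  · exact block_converse (P := jointChannel P) c.input hp hP'
      (fun s : S1 × S2 × W × W3 => (s.2.1, s.2.2.1, s.2.2.2)) (fun t : X1 × X2 × X3 => (t.2.1, t.2.2))
      (fun k z h => (c.enc2 (fun j => (z j).1) k, c.relay k (fun j => (h j).2) fun j => (z j).2.2)) (fun _ _ _ => rfl)
      (fun v z j => ((c.dec (fun j => (v j).1) (fun j => (z j).2.1)).1 j, z j))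
      _ herr0 fun ω h => herr1 ω fun hc => h (by simp only [hc])
  · exact block_converse (P := jointChannel P) c.input hp hP'
      (fun s : S1 × S2 × W × W3 => (s.1, s.2.2.1, s.2.2.2)) (fun t : X1 × X2 × X3 => (t.1, t.2.2))
      (fun k z h => (c.enc1 (fun j => (z j).1) k, c.relay k (fun j => (h j).2) fun j => (z j).2.2)) (fun _ _ _ => rfl)
      (fun v z j => ((z j).1, (c.dec (fun j => (v j).1) (fun j => (z j).2.1)).2 j, (z j).2))
      _ herr0 fun ω h => herr1 ω fun hc => h (by simp only [hc])
  · exact block_converse (P := jointChannel P) c.input hp hP'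
      (fun s : S1 × S2 × W × W3 => (s.2.2.1, s.2.2.2)) (fun t : X1 × X2 × X3 => t.2.2)
      (fun k z h => c.relay k (fun j => (h j).2) fun j => (z j).2) (fun _ _ _ => rfl)
      (fun v z j => ((c.dec (fun j => (v j).1) (fun j => (z j).1)).1 j, (c.dec (fun j => (v j).1) (fun j => (z j).1)).2 j, z j))
      _ herr0 fun ω h => herr1 ω fun hc => h (by simp only [hc])

/-- Reliable transmission forces the source entropies below an average of information vectors over
at most four input laws. For each block length the time average of the information vectors is, by
Carathéodory's theorem, an average over four input laws; these and their weights range over a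
compact set, and the Fano terms vanish in the limit. -/
theorem exists_entropyVector_le {p : S1 × S2 × W × W3 → ℝ}
    (hp : p ∈ stdSimplex ℝ (S1 × S2 × W × W3)) {P : X1 → X2 → X3 → Y × Y3 → ℝ}
    (hP : ∀ x1 x2 x3, P x1 x2 x3 ∈ stdSimplex ℝ (Y × Y3)) (h : ReliablyTransmissible p P) :
    ∃ w ∈ stdSimplex ℝ (Fin 4), ∃ π : Fin 4 → X1 × X2 × X3 → ℝ, (∀ q, π q ∈ inputLaws p) ∧
      ∀ i, entropyVector p i ≤ ∑ q, w q * infoVector P (π q) i := by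
  obtain ⟨c, hc⟩ := h
  set L := Real.log (Fintype.card (S1 × S2 × W × W3)) with hL
  have hblock : ∀ n : ℕ, ∃ a ∈ stdSimplex ℝ (Fin 4) ×ˢ
      (Set.univ.pi fun _ : Fin 4 => inputLaws (X1 := X1) (X2 := X2) (X3 := X3) p),
      ∀ i, entropyVector p i ≤ ∑ q, a.1 q * infoVector P (a.2 q) i +
        (Real.log 2 / ((n : ℝ) + 1) + (c (n + 1)).errorProb p P * L) := by
    intro n
    have hn : (0 : ℝ) < (n : ℝ) + 1 := by positivity
    have hmem : ∑ k : Fin (n + 1), (1 / ((n : ℝ) + 1)) •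
        infoVector P (inputLaw p (jointChannel P) (c (n + 1)).input k) ∈
        convexHull ℝ (infoVector P '' inputLaws p) := by
      refine (convex_convexHull ℝ _).sum_mem (fun _ _ => by positivity) ?_ fun k _ =>
        subset_convexHull ℝ _ ⟨_, (c (n + 1)).inputLaw_mem_inputLaws hp hP k, rfl⟩
      simp
      field_simp
    obtain ⟨w, hw, z, hz, hwz⟩ := exists_sum_smul_eq_of_mem_convexHull hmem
    choose π hπ hπz using hz
    refine ⟨(w, π), ⟨hw, fun q _ => hπ q⟩, fun i => ?_⟩
    have hi := (c (n + 1)).entropyVector_le hp hP i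
    have hwi := congrFun hwz i
    simp only [Finset.sum_apply, Pi.smul_apply, smul_eq_mul, ← Finset.mul_sum, ← hπz] at hwi
    rw [hwi]
    push_cast at hi
    have e : 1 / ((n : ℝ) + 1) * ∑ k, infoVector P
        (inputLaw p (jointChannel P) (c (n + 1)).input k) i +
        (Real.log 2 / ((n : ℝ) + 1) + (c (n + 1)).errorProb p P * L) =
        (∑ k, infoVector P (inputLaw p (jointChannel P) (c (n + 1)).input k) i + Real.log 2 +
        (c (n + 1)).errorProb p P * (((n : ℝ) + 1) * L)) / ((n : ℝ) + 1) := by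
      field_simp
      ring
    rw [e, le_div_iff₀ hn]
    linarith
  choose a ha hle using hblock
  obtain ⟨b, hb, φ, hφ, hlim⟩ := ((isCompact_stdSimplex ℝ (Fin 4)).prod
    (isCompact_univ_pi fun _ => isCompact_inputLaws p)).tendsto_subseq ha
  refine ⟨b.1, hb.1, b.2, fun q => hb.2 q (Set.mem_univ q), fun i => ?_⟩
  have hcont : Continuous fun a : (Fin 4 → ℝ) × (Fin 4 → X1 × X2 × X3 → ℝ) =>
      ∑ q, a.1 q * infoVector P (a.2 q) i := by
    refine continuous_finsetSum _ fun q _ => Continuous.mul (by fun_prop) ?_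
    exact (continuous_apply i).comp ((continuous_infoVector P).comp (by fun_prop))
  have h1 := (hcont.tendsto b).comp hlim
  have h2 : Filter.Tendsto (fun n : ℕ => Real.log 2 / ((n : ℝ) + 1) +
      (c (n + 1)).errorProb p P * L) Filter.atTop (𝓝 0) := by
    have h3 := (tendsto_one_div_add_atTop_nhds_zero_nat (𝕜 := ℝ)).const_mul (Real.log 2)
    have h4 := ((Filter.tendsto_add_atTop_iff_nat 1).2 hc).mul_const L
    simpa [div_eq_mul_inv] using h3.add h4
  have h5 := h1.add (h2.comp hφ.tendsto_atTop)
  rw [add_zero] at h5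
  exact ge_of_tendsto' h5 fun n => hle (φ n) i

/-- Disintegration of a law of the three inputs over the first two. -/
lemma exists_conditional {π : X1 × X2 × X3 → ℝ} (hπ : π ∈ stdSimplex ℝ (X1 × X2 × X3)) :
    ∃ r : X1 → X2 → X3 → ℝ, (∀ x1 x2, r x1 x2 ∈ stdSimplex ℝ X3) ∧
      ∀ x1 x2 x3, (∑ x3', π (x1, x2, x3')) * r x1 x2 x3 = π (x1, x2, x3) := by
  classical
  have hne : Nonempty X3 := by
    by_contra h
    have := hπ.2
    simp [not_nonempty_iff.1 h] at this
  obtain ⟨x₀⟩ := hne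
  refine ⟨fun x1 x2 => if ∑ x3', π (x1, x2, x3') = 0 then Pi.single x₀ 1 else
    fun x3 => π (x1, x2, x3) / ∑ x3', π (x1, x2, x3'), fun x1 x2 => ?_, fun x1 x2 x3 => ?_⟩
  · dsimp only
    split_ifs with h
    · exact single_mem_stdSimplex ℝ _
    · refine ⟨fun x3 => div_nonneg (hπ.1 _) (Finset.sum_nonneg fun _ _ => hπ.1 _), ?_⟩
      rw [← Finset.sum_div, div_self h]
  · dsimp only
    split_ifs with h
    · rw [h, zero_mul, eq_comm]
      exact (Finset.sum_eq_zero_iff_of_nonneg fun _ _ => hπ.1 _).1 h x3 (Finset.mem_univ _)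
    · rw [mul_div_cancel₀ _ h]

end Codes

end MARC

end

/-! ### The single-letter converse -/

theorem mainTheorem3
    {S1 S2 W W3 X1 X2 X3 Y Y3 : Type*}
    [Fintype S1] [Fintype S2] [Fintype W] [Fintype W3] [Fintype X1] [Fintype X2] [Fintype X3]
    [Fintype Y] [Fintype Y3]
    (p : S1 × S2 × W × W3 → ℝ) (hp : p ∈ stdSimplex ℝ (S1 × S2 × W × W3))
    (P : X1 → X2 → X3 → Y × Y3 → ℝ) (hP : ∀ x1 x2 x3, P x1 x2 x3 ∈ stdSimplex ℝ (Y × Y3)) :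
    closure (MARC.setB X1 X2 (MARC.sourcePair p)) ⊆ MARC.setB' X1 X2 (MARC.sourcePair p) ∧
    (MARC.ReliablyTransmissible p P →
      ∃ m : ℕ, m ≤ 4 ∧
      ∃ (pQ : Fin m → ℝ) (κ : Fin m → S1 × S2 → X1 × X2 → ℝ)
        (r : Fin m → X1 → X2 → W3 → X3 → ℝ),
        pQ ∈ stdSimplex ℝ (Fin m) ∧
        (∀ q, κ q ∈ closure (MARC.setB X1 X2 (MARC.sourcePair p))) ∧
        (∀ q x1 x2 w3, r q x1 x2 w3 ∈ stdSimplex ℝ X3) ∧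
        -- `H(S₁|S₂,W,W₃) ≤ I(X₁;Y,Y₃|S₂,X₂,X₃,W,Q)`
        MARC.condEntropy p (fun (s1, _, _, _) => s1) (fun (_, s2, w, w3) => (s2, w, w3)) ≤
          MARC.condMutualInfo (MARC.singleLetterLaw pQ p κ r P)
            (fun (_, _, (x1, _, _), _) => x1)
            (fun (_, _, _, (y, y3)) => (y, y3))
            (fun (q, (_, s2, w, _), (_, x2, x3), _) => (s2, x2, x3, w, q)) ∧
        -- `H(S₂|S₁,W,W₃) ≤ I(X₂;Y,Y₃|S₁,X₁,X₃,W,Q)`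
        MARC.condEntropy p (fun (_, s2, _, _) => s2) (fun (s1, _, w, w3) => (s1, w, w3)) ≤
          MARC.condMutualInfo (MARC.singleLetterLaw pQ p κ r P)
            (fun (_, _, (_, x2, _), _) => x2)
            (fun (_, _, _, (y, y3)) => (y, y3))
            (fun (q, (s1, _, w, _), (x1, _, x3), _) => (s1, x1, x3, w, q)) ∧
        -- `H(S₁,S₂|W,W₃) ≤ I(X₁,X₂;Y,Y₃|X₃,W,Q)`
        MARC.condEntropy p (fun (s1, s2, _, _) => (s1, s2)) (fun (_, _, w, w3) => (w, w3)) ≤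
          MARC.condMutualInfo (MARC.singleLetterLaw pQ p κ r P)
            (fun (_, _, (x1, x2, _), _) => (x1, x2))
            (fun (_, _, _, (y, y3)) => (y, y3))
            (fun (q, (_, _, w, _), (_, _, x3), _) => (x3, w, q))) := by
  classical
  have hpS : MARC.sourcePair p ∈ stdSimplex ℝ (S1 × S2) := MARC.law_mem_stdSimplex hp _
  refine ⟨MARC.closure_setB_subset_setB' hpS, fun h => ?_⟩
  obtain ⟨w, hw, π, hπ, hle⟩ := MARC.exists_entropyVector_le hp hP h
  -- The inputs are independent of the sources, so `κ` does not depend on `(s₁, s₂)` nor `r` on `w₃`.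
  choose r hr hrπ using fun q => MARC.exists_conditional (hπ q).1
  have hμ : ∀ q s t y, MARC.singleLetterLaw w p (fun q _ x => ∑ x3, π q (x.1, x.2, x3))
      (fun q x1 x2 _ => r q x1 x2) P (q, s, t, y) =
        w q * p s * π q t * MARC.jointChannel P t y := by
    rintro q ⟨s1, s2, a, a3⟩ ⟨x1, x2, x3⟩ ⟨y, y3⟩
    simp only [MARC.singleLetterLaw, MARC.jointChannel]
    rw [mul_assoc (w q * _), hrπ]
  have hP' : ∀ t, MARC.jointChannel P t ∈ stdSimplex ℝ (Y × Y3) := fun t => hP _ _ _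
  have hlog : (0 : ℝ) < Real.log 2 := Real.log_pos one_lt_two
  refine ⟨4, le_rfl, w, fun q _ x => ∑ x3, π q (x.1, x.2, x3), fun q x1 x2 _ => r q x1 x2, hw,
    fun q => (hπ q).2, fun q x1 x2 _ => hr q x1 x2, ?_, ?_, ?_⟩
  · rw [MARC.condEntropy_eq_of_injective hp.1 _ _ fun s s' h => by
      simp only [Prod.mk.injEq] at h; ext <;> simp [h],
      MARC.condMutualInfo_product (b := fun s : S1 × S2 × W × W3 => (s.2.1, s.2.2.1))
        (u := fun t : X1 × X2 × X3 => (t.2.1, t.2.2)) (x := fun t => t.1) hμ hw.1 hp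
        (fun q => (hπ q).1.1) hP' (fun _ _ _ _ => rfl)
        (fun _ _ _ _ _ _ _ _ => by simp only [Prod.mk.injEq]; tauto)
        (fun t t' h1 h2 => by simp only [Prod.mk.injEq] at h2; ext <;> simp [h1, h2])]
    exact div_le_div_of_nonneg_right (hle 0) hlog.le
  · rw [MARC.condEntropy_eq_of_injective hp.1 _ _ fun s s' h => by
      simp only [Prod.mk.injEq] at h; ext <;> simp [h],
      MARC.condMutualInfo_product (b := fun s : S1 × S2 × W × W3 => (s.1, s.2.2.1))
        (u := fun t : X1 × X2 × X3 => (t.1, t.2.2)) (x := fun t => t.2.1) hμ hw.1 hp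
        (fun q => (hπ q).1.1) hP' (fun _ _ _ _ => rfl)
        (fun _ _ _ _ _ _ _ _ => by simp only [Prod.mk.injEq]; tauto)
        (fun t t' h1 h2 => by simp only [Prod.mk.injEq] at h2; ext <;> simp [h1, h2])]
    exact div_le_div_of_nonneg_right (hle 1) hlog.le
  · rw [MARC.condEntropy_eq_of_injective hp.1 _ _ fun s s' h => by
      simp only [Prod.mk.injEq] at h; ext <;> simp [h],
      MARC.condMutualInfo_product (b := fun s : S1 × S2 × W × W3 => s.2.2.1)
        (u := fun t : X1 × X2 × X3 => t.2.2) (x := fun t => (t.1, t.2.1)) hμ hw.1 hp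
        (fun q => (hπ q).1.1) hP' (fun _ _ _ _ => rfl)
        (fun _ _ _ _ _ _ _ _ => by simp only [Prod.mk.injEq]; tauto)
        (fun t t' h1 h2 => by simp only [Prod.mk.injEq] at h1; ext <;> simp [h1, h2])]
    exact div_le_div_of_nonneg_right (hle 2) hlog.le
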